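/- Let $\mathcal H$ be a complex Hilbert space and let $\mathcal V,\mathcal W\subset\mathcal H$ be finite dimensional subspaces with $\mathcal W^\perp\oplus\mathcal V=\mathcal H$ (direct, not necessarily orthogonal, sum); let $d=\dim\mathcal V=\dim\mathcal W$. Let $\mathcal F=(f_i)_{i=1}^n$ be a frame for $\mathcal W$, i.e. $f_i\in\mathcal W$ and there are $0<A<B$ with $A\|f\|^2\le\sum_i|\langle f,f_i\rangle|^2\le B\|f\|^2$ for all $f\in\mathcal W$. *Notation.* For $\mathcal G=(g_i)_{i=1}^n\in\mathcal H^n$ let $T_{\mathcal G}:\mathbb C^n\to\mathcal H$, $T_{\mathcal G}a=\sum_i a_ig_i$, and $S_{\mathcal G}=T_{\mathcal G}T_{\mathcal G}^*$. Let $\lambda(S_{\mathcal G})=(\lambda_i(S_{\mathcal G}))_{i\ge1}$ be the eigenvalues of the compression of $S_{\mathcal G}$ to $\operatorname{span}\mathcal G$, with multiplicity and in non-increasing order, followed by zeros (up to the index $\dim\mathcal H$). For a convex $h:[0,\infty)\to[0,\infty)$ put $P_h(\mathcal G)=\sum_{i=1}^{\dim\operatorname{span}\mathcal G}h(\lambda_i(S_{\mathcal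 G}))$. Call $\mathcal G$ a $\mathcal V$-dual of $\mathcal F$ if $g_i\in\mathcal V$ for all $i$ and $g=\sum_i\langle g,f_i\rangle g_i$ for every $g\in\mathcal V$. For $t\in\mathbb R$ let $\mathcal D_{\mathcal V,t}(\mathcal F)$ be the set of $\mathcal V$-duals $\mathcal G$ of $\mathcal F$ with $\sum_i\|g_i\|^2\ge t$. The canonical $\mathcal V$-dual is $\mathcal F^\#_{\mathcal V}=(P\,S_{\mathcal F}^\dagger f_i)_{i=1}^n$, where $P$ is the projection onto $\mathcal V$ along $\mathcal W^\perp$ and $\dagger$ is the Moore–Penrose pseudo-inverse. Put $\lambda=\lambda(S_{\mathcal F^\#_{\mathcal V}})$, $\operatorname{tr}\lambda=\sum_i\lambda_i$, $m=2d-n$ and $x^+=\max(x,0)$. **Theorem.** Let $t\ge\operatorname{tr}\lambda$, and assume that $1\le d<n$ or that $t=\operatorname{tr}\lambda$. Then there is a number $c\ge\lambda_d$ (the condition on $\lambda_d$ being $c\ge 0$ if $d=0$), unique if $1\le d<n$, with $$\sum_{i=\max\{m,0\}+1}^d(c-\lambda_i)^+=t-\operatorname{tr}\lambda .$$ Let $\nu$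 be the non-increasing rearrangement of the vector $(\nu'_i)_{i=1}^d$ given by $\nu'_i=\lambda_i$ for $i\le m$ and $\nu'_i=(c-\lambda_i)^++\lambda_i$ for $i>m$, followed by zeros. Then $\nu$ is a non-increasing, non-negative, summable sequence (indexed by $i\le\dim\mathcal H$), and there is $\mathcal G_{\rm op}\in\mathcal D_{\mathcal V,t}(\mathcal F)$, not depending on $h$, such that: 1. $\lambda(S_{\mathcal G_{\rm op}})=\nu$. 2. For every non-decreasing convex $h:[0,\infty)\to[0,\infty)$ and every $\mathcal G\in\mathcal D_{\mathcal V,t}(\mathcal F)$, $P_h(\mathcal G_{\rm op})\le P_h(\mathcal G)$. 3. If moreover $h$ is strictly convex and $\mathcal G\in\mathcal D_{\mathcal V,t}(\mathcal F)$ satisfies $P_h(\mathcal G)=P_h(\mathcal G_{\rm op})$, then $\lambda(S_{\mathcal G})=\nu$ and there is an orthonormal basis $(x_i)_{i=1}^d$ of $\mathcal V$ such that $$S_{\mathcal F^\#_{\mathcal V}}=\sum_{i=1}^d\lambda_i\,x_i\otimes x_i,\qquad B:=S_{\mathcal G}-S_{\mathcal F^\#_{\mathcal V}}=\sum_{i=1}^d\lambda_{d-i+1}(B)\,x_i\otimes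 x_i ,$$ where $(x\otimes x)f=\langle f,x\rangle x$ and $\lambda_1(B)\ge\dots\ge\lambda_d(B)$ are the eigenvalues of the compression of $B$ to $\mathcal V$, with multiplicity. -/

import Mathlib

open InnerProductSpace
open scoped ComplexInnerProductSpace

noncomputable section

namespace ObliqueDual

variable {H : Type*} [NormedAddCommGroup H] [InnerProductSpace ℂ H]

/-- A finite sequence `F` is a frame for the subspace `W` if all `F i` lie in `W` and the two frame
inequalities hold on `W`. -/
def IsFrameFor {n : ℕ} (W : Submodule ℂ H) (F : Fin n → H) : Prop :=
  (∀ i, F i ∈ W) ∧ ∃ A B : ℝ, 0 < A ∧ A < B ∧ ∀ f ∈ W,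
    A * ‖f‖ ^ 2 ≤ ∑ i, ‖⟪f, F i⟫_ℂ‖ ^ 2 ∧ ∑ i, ‖⟪f, F i⟫_ℂ‖ ^ 2 ≤ B * ‖f‖ ^ 2

/-- The synthesis operator `a ↦ ∑ i, a i • F i`. -/
def synthesis {n : ℕ} (F : Fin n → H) : EuclideanSpace ℂ (Fin n) →L[ℂ] H :=
  ∑ i, (EuclideanSpace.proj i : EuclideanSpace ℂ (Fin n) →L[ℂ] ℂ).smulRight (F i)

variable [CompleteSpace H]

/-- The analysis operator, the adjoint of the synthesis operator. -/
def analysis {n : ℕ} (F : Fin n → H) : H →L[ℂ] EuclideanSpace ℂ (Fin n) :=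
  ContinuousLinearMap.adjoint (synthesis F)

/-- The frame operator `S = T ∘ T†`. -/
def frameOp {n : ℕ} (F : Fin n → H) : H →L[ℂ] H :=
  synthesis F ∘L analysis F

theorem frameOp_isSelfAdjoint {n : ℕ} (F : Fin n → H) : IsSelfAdjoint (frameOp F) := by
  rw [ContinuousLinearMap.isSelfAdjoint_iff']
  simp [frameOp, analysis, ContinuousLinearMap.adjoint_comp]

/-- `G` is an oblique `V`-dual of `F`: it lies in `V` and `T_G T_F† g = g` for all `g ∈ V`. -/
def IsObliqueDual {n : ℕ} (V : Submodule ℂ H) (F G : Fin n → H) : Prop :=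
  (∀ i, G i ∈ V) ∧ ∀ g ∈ V, synthesis G (analysis F g) = g

/-- The set of oblique `V`-duals of `F` with `∑ ‖G i‖² ≥ t`. -/
def dualsAbove {n : ℕ} (V : Submodule ℂ H) (t : ℝ) (F : Fin n → H) : Set (Fin n → H) :=
  {G | IsObliqueDual V F G ∧ t ≤ ∑ i, ‖G i‖ ^ 2}

/-- The four Penrose equations. -/
structure IsMoorePenrose (S X : H →L[ℂ] H) : Prop where
  mul_mul_left : S ∘L X ∘L S = S
  mul_mul_right : X ∘L S ∘L X = X
  left_selfAdjoint : IsSelfAdjoint (S ∘L X)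
  right_selfAdjoint : IsSelfAdjoint (X ∘L S)

open Classical in
/-- The Moore-Penrose pseudo-inverse of `S` (and `0` if there is none). -/
def moorePenrose (S : H →L[ℂ] H) : H →L[ℂ] H :=
  if h : ∃ X, IsMoorePenrose S X then h.choose else 0

theorem IsMoorePenrose.unique {S X Y : H →L[ℂ] H} (hX : IsMoorePenrose S X)
    (hY : IsMoorePenrose S Y) : X = Y := by
  have e1 : S * X * S = S := by rw [mul_assoc]; exact hX.mul_mul_left
  have e2 : X * S * X = X := by rw [mul_assoc]; exact hX.mul_mul_right
  have e3 : star (S * X) = S * X := hX.left_selfAdjoint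
  have e4 : star (X * S) = X * S := hX.right_selfAdjoint
  have f1 : S * Y * S = S := by rw [mul_assoc]; exact hY.mul_mul_left
  have f2 : Y * S * Y = Y := by rw [mul_assoc]; exact hY.mul_mul_right
  have f3 : star (S * Y) = S * Y := hY.left_selfAdjoint
  have f4 : star (Y * S) = Y * S := hY.right_selfAdjoint
  have h1 : S * X = S * Y := by
    have : star (S * Y * (S * X)) = star (S * X) := by rw [← mul_assoc, f1]
    rw [star_mul, e3, f3, ← mul_assoc, e1] at this
    exact this.symm
  have h2 : X * S = Y * S := by
    have : star (X * S * (Y * S)) = star (X * S) := by rw [mul_assoc, ← mul_assoc S, f1]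
    rw [star_mul, e4, f4, mul_assoc, ← mul_assoc S, e1] at this
    exact this.symm
  calc X = X * S * X := e2.symm
    _ = Y * (S * X) := by rw [h2, mul_assoc]
    _ = Y := by rw [h1, ← mul_assoc, f2]

/-- A self-adjoint operator with finite-dimensional range has a Moore-Penrose pseudo-inverse. -/
theorem exists_isMoorePenrose {S : H →L[ℂ] H} (hS : IsSelfAdjoint S)
    [FiniteDimensional ℂ (LinearMap.range (S : H →ₗ[ℂ] H))] : ∃ X, IsMoorePenrose S X := by
  set R := LinearMap.range (S : H →ₗ[ℂ] H) with hR
  have hsym : ∀ x y, ⟪S x, y⟫_ℂ = ⟪x, S y⟫_ℂ := hS.isSymmetric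
  have hmem : ∀ x, S x ∈ R := fun x => ⟨x, rfl⟩
  let s : R →ₗ[ℂ] R := (S : H →ₗ[ℂ] H).restrict (fun x _ => hmem x)
  have hs : ∀ x : R, ((s x : R) : H) = S x := fun x => rfl
  have hinj : Function.Injective s := by
    rw [injective_iff_map_eq_zero]
    rintro ⟨x, y, rfl⟩ hx
    have h0 : S (S y) = 0 := congrArg Subtype.val hx
    have h1 : S y = 0 := by
      rw [← inner_self_eq_zero (𝕜 := ℂ), hsym, h0, inner_zero_right]
    exact Subtype.ext h1
  let e : R ≃ₗ[ℂ] R := LinearEquiv.ofInjectiveEndo s hinj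
  have he : ∀ x : R, S (e.symm x : H) = x := fun x => by
    have : e (e.symm x) = x := e.apply_symm_apply x
    exact congrArg Subtype.val this
  have he' : ∀ x : R, e.symm ⟨S x, hmem x⟩ = x := fun x => by
    rw [LinearEquiv.symm_apply_eq]
    rfl
  let P : H →L[ℂ] R := R.orthogonalProjectionOnto
  have hSP : ∀ x, S (P x : H) = S x := fun x => by
    have h1 : S (x - P x) = 0 := by
      rw [← inner_self_eq_zero (𝕜 := ℂ), hsym]
      refine Submodule.inner_left_of_mem_orthogonal (K := R) (hmem _) ?_
      exact R.sub_starProjection_mem_orthogonal x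
    rw [map_sub, sub_eq_zero] at h1
    exact h1.symm
  have hPmem : ∀ x : H, ∀ hx : x ∈ R, P x = ⟨x, hx⟩ := fun x hx =>
    R.orthogonalProjectionOnto_mem_subspace_eq_self ⟨x, hx⟩
  let X : H →L[ℂ] H := R.subtypeL ∘L (LinearMap.toContinuousLinearMap (e.symm : R →ₗ[ℂ] R)) ∘L P
  have hX : ∀ x, X x = (e.symm (P x) : H) := fun x => rfl
  have hSX : S ∘L X = R.starProjection := by
    ext x
    change S (X x) = _
    rw [hX, he]
    rfl
  have hXS : X ∘L S = R.starProjection := by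
    ext x
    change X (S x) = _
    rw [hX, hPmem _ (hmem x)]
    have : (⟨S x, hmem x⟩ : R) = ⟨S (P x : H), hmem _⟩ := Subtype.ext (hSP x).symm
    rw [this, he']
    rfl
  refine ⟨X, ?_, ?_, ?_, ?_⟩
  · rw [hXS]
    ext x
    exact hSP x
  · rw [hSX]
    ext x
    change X (P x : H) = X x
    rw [hX, hX, hPmem _ (P x).2]
  · rw [hSX]
    exact isSelfAdjoint_starProjection R
  · rw [hXS]
    exact isSelfAdjoint_starProjection R

/-- The oblique canonical `V`-dual of `F`: `F i ↦ P (S_F^† (F i))`, where `P` is the projection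
onto `V` along `Wᗮ`. -/
def canonicalDual {n : ℕ} {V W : Submodule ℂ H} (hVW : IsCompl V Wᗮ) (F : Fin n → H) :
    Fin n → H :=
  fun i => V.projection Wᗮ hVW (moorePenrose (frameOp F) (F i))

/-- The compression of `T` to the subspace `U`. -/
def compression (U : Submodule ℂ H) [FiniteDimensional ℂ U] (T : H →L[ℂ] H) : U →L[ℂ] U :=
  U.orthogonalProjectionOnto ∘L T ∘L U.subtypeL

theorem compression_isSymmetric (U : Submodule ℂ H) [FiniteDimensional ℂ U] {T : H →L[ℂ] H}
    (hT : IsSelfAdjoint T) : (compression U T : U →ₗ[ℂ] U).IsSymmetric := by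
  intro x y
  have := hT.isSymmetric (x : H) (y : H)
  simpa [compression] using this

/-- The eigenvalues of the compression of the self-adjoint operator `T` to `U`, with multiplicity
and in non-increasing order (indices start at `0`), followed by zeros. -/
def eigenvalueSeq (U : Submodule ℂ H) [FiniteDimensional ℂ U] {T : H →L[ℂ] H}
    (hT : IsSelfAdjoint T) (i : ℕ) : ℝ :=
  if h : i < Module.finrank ℂ U then
    (compression_isSymmetric U hT).eigenvalues rfl ⟨i, h⟩
  else 0

instance finiteDimensional_span_family {n : ℕ} (F : Fin n → H) :
    FiniteDimensional ℂ (Submodule.span ℂ (Set.range F)) :=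
  FiniteDimensional.span_of_finite ℂ (Set.finite_range F)

/-- The spectrum `λ(S_F)` of the frame operator: the eigenvalues of the compression of `S_F` to
`span F`, in non-increasing order, followed by zeros. -/
def frameSpectrum {n : ℕ} (F : Fin n → H) : ℕ → ℝ :=
  eigenvalueSeq (Submodule.span ℂ (Set.range F)) (frameOp_isSelfAdjoint F)

/-- The spectrum of the frame operator of the oblique canonical `V`-dual of `F`. -/
abbrev canonicalSpectrum {n : ℕ} {V W : Submodule ℂ H} (hVW : IsCompl V Wᗮ) (F : Fin n → H) :
    ℕ → ℝ :=
  frameSpectrum (canonicalDual hVW F)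

/-- The convex potential `P_h(F)`, the sum of `h` over the eigenvalues of the compression of `S_F`
to `span F`. -/
def convexPotential {n : ℕ} (h : ℝ → ℝ) (F : Fin n → H) : ℝ :=
  ∑ i ∈ Finset.range (Module.finrank ℂ (Submodule.span ℂ (Set.range F))), h (frameSpectrum F i)

/-- Non-increasing, non-negative, summable sequences indexed by the dimension of `H`, extended by
zero to `ℕ` if that dimension is finite. -/
structure IsSummableDecreasing (H : Type*) [NormedAddCommGroup H] [InnerProductSpace ℂ H]
    (x : ℕ → ℝ) : Prop where
  antitone : Antitone x
  nonneg : ∀ i, 0 ≤ x i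
  summable : Summable x
  eq_zero : ∀ i : ℕ, Module.rank ℂ H ≤ (i : Cardinal) → x i = 0

/-- The trace of a sequence. -/
def seqTrace (x : ℕ → ℝ) : ℝ := ∑' i, x i

/-- `c` is the water level for `l 0 ≥ … ≥ l (d - 1)`, `m` and `t`: `c ≥ l (d - 1)`, and the sum of
`(c - l i)⁺` over the entries after the first `max m 0` of them is `t - tr l`. -/
def IsWaterLevel (l : ℕ → ℝ) (d : ℕ) (m : ℤ) (t c : ℝ) : Prop :=
  l (d - 1) ≤ c ∧ ∑ i ∈ Finset.Ico (max m 0).toNat d, max (c - l i) 0 = t - seqTrace l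

/-- The non-increasing rearrangement of a vector. -/
def sortDesc {d : ℕ} (v : Fin d → ℝ) : Fin d → ℝ :=
  v ∘ Tuple.sort (fun i => -v i)

/-- The water-filling of `l 0 ≥ … ≥ l (d - 1)` at level `c`: the first `max m 0` entries are kept,
every later entry `l i` becomes `(c - l i)⁺ + l i`; the result is rearranged in non-increasing
order and followed by zeros. -/
def waterFilling (l : ℕ → ℝ) (d : ℕ) (m : ℤ) (c : ℝ) (i : ℕ) : ℝ :=
  if h : i < d then
    sortDesc (fun j : Fin d => if (j : ℤ) < m then l j else max (c - l j) 0 + l j) ⟨i, h⟩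
  else 0

/-- `h` restricts to a convex function from `[0, ∞)` to `[0, ∞)`. -/
def IsConvexPotentialFun (h : ℝ → ℝ) : Prop :=
  (∀ x, 0 ≤ x → 0 ≤ h x) ∧ ConvexOn ℝ (Set.Ici 0) h

end ObliqueDual

end

/-! Write `A` and `S_G` for the frame operators of the canonical dual and of a `V`-dual `G`, and put
`r = n - d`. If `Y = G - canonicalDual hVW F`, then `T_Y T_F† = 0`, and the range of the canonical
analysis operator lies in that of `T_F†`. The cross terms therefore vanish and `S_G = A + S_Y`
(`IsObliqueDual.frameOp_sub`). Here `S_Y ≥ 0` has rank at most `r`, because `T_Y` kills the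
`d`-dimensional space `T_F† V`. Conversely, `exists_family_frameOp_eq` realizes the perturbations
needed for the optimum. Since every dual spans `V`, potentials are sums over exactly `d` positive
eigenvalues, whose total is `∑ ‖G i‖²`.

Let `μ` be the spectrum of `S_G`. Weyl's inequality (`eigenvalue_le_of_le_on`) gives `α i ≤ μ i` and
`μ (j + r) ≤ α j`, with `α` the canonical spectrum. Pigeonhole on the sorted water-filling `ν` turns
this into: `ν i ≤ μ i` where `ν i > c`, and `μ i ≤ ν i` where `ν i < c`. Thus replacing the slopes
of `h` at the `ν i` by its slope at `c` only decreases `∑ h'(ν i) (μ i - ν i)`. The slope at `c` is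
non-negative and the trace constraint gives `∑ ν ≤ ∑ μ`, so the subgradient inequality yields
optimality; strict convexity forces `μ = ν` in case of equality (`sum_convex_le`,
`eq_of_sum_convex_eq`).

For the equality structure, `∑ (c - ν i)²` is exactly the least squared Hilbert-Schmidt distance
from `c • 1 - A` to the non-negative operators of rank at most `r`. So `B = S_G - A` is a best
approximation of Eckart-Young type. This makes `B` commute with `A`, and an exchange argument orders
their joint eigenvalues oppositely (`exists_opposite_eigenbasis`). -/

noncomputable section

namespace ObliqueDual

/-! ### Weyl inequalities and best approximation by low-rank non-negative operators. -/

section LinearAlgebra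

variable {E : Type*} [NormedAddCommGroup E] [InnerProductSpace ℂ E] {d : ℕ}

theorem inner_apply_of_eigenbasis (e : OrthonormalBasis (Fin d) ℂ E) {T : E →ₗ[ℂ] E}
    (hT : T.IsSymmetric) {α : Fin d → ℝ} (h : ∀ i, T (e i) = (α i : ℂ) • e i) (i : Fin d) (x : E) :
    ⟪e i, T x⟫_ℂ = α i * ⟪e i, x⟫_ℂ := by
  rw [← hT, h, inner_smul_left, Complex.conj_ofReal]

theorem re_inner_apply_of_eigenbasis (e : OrthonormalBasis (Fin d) ℂ E) {T : E →ₗ[ℂ] E}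
    (hT : T.IsSymmetric) {α : Fin d → ℝ} (h : ∀ i, T (e i) = (α i : ℂ) • e i) (x : E) :
    (⟪x, T x⟫_ℂ).re = ∑ i, α i * ‖⟪e i, x⟫_ℂ‖ ^ 2 := by
  rw [← e.sum_inner_mul_inner x (T x), Complex.re_sum]
  refine Finset.sum_congr rfl fun i _ => ?_
  rw [inner_apply_of_eigenbasis e hT h, mul_left_comm, ← inner_conj_symm x (e i),
    Complex.conj_mul']
  norm_cast

/-- Weyl's inequality for two symmetric operators compared on a subspace of codimension at
most `r`. -/
theorem eigenvalue_le_of_le_on (e f : OrthonormalBasis (Fin d) ℂ E) {T S : E →ₗ[ℂ] E}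
    (hT : T.IsSymmetric) (hS : S.IsSymmetric) {α β : Fin d → ℝ} (hα : Antitone α)
    (hβ : Antitone β) (he : ∀ i, T (e i) = (α i : ℂ) • e i)
    (hf : ∀ i, S (f i) = (β i : ℂ) • f i) (K : Submodule ℂ E) {r : ℕ}
    (hK : d ≤ Module.finrank ℂ K + r)
    (hle : ∀ x ∈ K, (⟪x, T x⟫_ℂ).re ≤ (⟪x, S x⟫_ℂ).re) {i j : Fin d} (hij : (j : ℕ) = i + r) :
    α j ≤ β i := by
  have : FiniteDimensional ℂ E := e.toBasis.finiteDimensional_of_finite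
  let L : K →ₗ[ℂ] ({k : Fin d // j < k} ⊕ {k : Fin d // k < i} → ℂ) :=
    LinearMap.pi (Sum.elim (fun k => (innerSL ℂ (e k) : E →ₗ[ℂ] ℂ) ∘ₗ K.subtype)
      (fun k => (innerSL ℂ (f k) : E →ₗ[ℂ] ℂ) ∘ₗ K.subtype))
  -- There are `(d - 1 - j) + i = d - 1 - r` conditions, fewer than the dimension of `K`, so some
  -- nonzero `x` in `K` satisfies all of them.
  have hker : LinearMap.ker L ≠ ⊥ := by
    apply LinearMap.ker_ne_bot_of_finrank_lt
    rw [Module.finrank_fintype_fun_eq_card, Fintype.card_sum, Fintype.card_subtype,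
      Fintype.card_subtype]
    have h1 : (Finset.univ.filter (fun k => j < k)).card = d - 1 - j := by
      rw [← Fin.card_Ioi]; congr 1; ext; simp
    have h2 : (Finset.univ.filter (fun k => k < i)).card = i := by
      rw [← Fin.card_Iio]; congr 1; ext; simp
    have := j.2
    omega
  obtain ⟨x, hx, hx0⟩ := (Submodule.ne_bot_iff _).1 hker
  have h1 : ∀ k, j < k → ⟪e k, (x : E)⟫_ℂ = 0 := fun k hk => congrFun hx (Sum.inl ⟨k, hk⟩)
  have h2 : ∀ k, k < i → ⟪f k, (x : E)⟫_ℂ = 0 := fun k hk => congrFun hx (Sum.inr ⟨k, hk⟩)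
  have h3 : α j * ‖(x : E)‖ ^ 2 ≤ (⟪(x : E), T x⟫_ℂ).re := by
    rw [re_inner_apply_of_eigenbasis e hT he, ← e.sum_sq_norm_inner_right, Finset.mul_sum]
    refine Finset.sum_le_sum fun k _ => ?_
    rcases le_or_gt k j with hk | hk
    · exact mul_le_mul_of_nonneg_right (hα hk) (by positivity)
    · simp [h1 k hk]
  have h4 : (⟪(x : E), S x⟫_ℂ).re ≤ β i * ‖(x : E)‖ ^ 2 := by
    rw [re_inner_apply_of_eigenbasis f hS hf, ← f.sum_sq_norm_inner_right, Finset.mul_sum]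
    refine Finset.sum_le_sum fun k _ => ?_
    rcases le_or_gt i k with hk | hk
    · exact mul_le_mul_of_nonneg_right (hβ hk) (by positivity)
    · simp [h2 k hk]
  have h5 : 0 < ‖(x : E)‖ ^ 2 := by
    have : (x : E) ≠ 0 := fun h => hx0 (Subtype.ext h)
    positivity
  exact le_of_mul_le_mul_right (h3.trans ((hle x x.2).trans h4)) h5

/-- The eigenvalues of a symmetric operator, in non-increasing order, are unique. -/
theorem antitone_eigenvalues_unique (e f : OrthonormalBasis (Fin d) ℂ E) {T : E →ₗ[ℂ] E}
    (hT : T.IsSymmetric) {α β : Fin d → ℝ} (hα : Antitone α)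
    (hβ : Antitone β) (he : ∀ i, T (e i) = (α i : ℂ) • e i)
    (hf : ∀ i, T (f i) = (β i : ℂ) • f i) : α = β := by
  have hd : d ≤ Module.finrank ℂ (⊤ : Submodule ℂ E) + 0 := by
    rw [finrank_top, Module.finrank_eq_card_basis e.toBasis, Fintype.card_fin]; rfl
  funext i
  exact le_antisymm
    (eigenvalue_le_of_le_on e f hT hT hα hβ he hf ⊤ hd (fun _ _ => le_rfl) rfl)
    (eigenvalue_le_of_le_on f e hT hT hβ hα hf he ⊤ hd (fun _ _ => le_rfl) rfl)

/-- Basis independence of the Hilbert-Schmidt norm: both sides expand into the same double sum of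
matrix entries. -/
theorem sum_sq_norm_apply_eq (e f : OrthonormalBasis (Fin d) ℂ E) {T : E →ₗ[ℂ] E}
    (hT : T.IsSymmetric) : ∑ i, ‖T (e i)‖ ^ 2 = ∑ i, ‖T (f i)‖ ^ 2 := by
  simp_rw [← f.sum_sq_norm_inner_right (T (e _)), ← e.sum_sq_norm_inner_left (T (f _))]
  rw [Finset.sum_comm]
  refine Finset.sum_congr rfl fun i _ => Finset.sum_congr rfl fun j _ => ?_
  rw [hT]

theorem sq_sub_ge {m b : ℝ} (hb : 0 ≤ b) :
    m ^ 2 - max m 0 ^ 2 + (b - max m 0) ^ 2 ≤ (m - b) ^ 2 := by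
  rcases le_total m 0 with h | h
  · rw [max_eq_right h]; nlinarith
  · rw [max_eq_left h]; nlinarith

/-- Bathtub principle: mass at most `r`, with at most `1` per site, gains most on the `r` largest
weights. The proof subtracts the threshold weight at index `d - r`. -/
theorem sum_mul_le_sum_top {w D : Fin d → ℝ} (hw : Monotone w) (hw0 : ∀ i, 0 ≤ w i)
    (hD0 : ∀ i, 0 ≤ D i) (hD1 : ∀ i, D i ≤ 1) {r : ℕ} (hD : ∑ i, D i ≤ r) :
    ∑ i, w i * D i ≤ ∑ i : Fin d, if d ≤ i + r then w i else 0 := by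
  by_cases hr : r < d
  · have hr' : d - r - 1 + 1 = d - r := by omega
    by_cases hr0 : r = 0
    · subst hr0
      have : ∀ i, D i = 0 := by
        have h0 : ∑ i, D i = 0 := le_antisymm (by simpa using hD) (Finset.sum_nonneg fun i _ => hD0 i)
        intro i
        exact (Finset.sum_eq_zero_iff_of_nonneg (fun i _ => hD0 i)).1 h0 i (Finset.mem_univ i)
      simp only [this, mul_zero, Finset.sum_const_zero]
      exact Finset.sum_nonneg fun i _ => by split_ifs <;> simp [hw0]
    let q : Fin d := ⟨d - r, by omega⟩
    have hcard : (∑ i : Fin d, if d ≤ (i : ℕ) + r then (1 : ℝ) else 0) = r := by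
      rw [Finset.sum_boole]
      have : (Finset.univ.filter (fun i : Fin d => d ≤ (i : ℕ) + r)) = Finset.Ici q := by
        ext i; simp only [Finset.mem_filter, Finset.mem_univ, true_and, Finset.mem_Ici, Fin.le_def, q]
        omega
      rw [this, Fin.card_Ici]
      congr 1
      simp only [q]; omega
    have h1 : ∑ i, (w i - w q) * D i ≤ ∑ i : Fin d, (w i - w q) * (if d ≤ (i : ℕ) + r then 1 else 0) := by
      refine Finset.sum_le_sum fun i _ => ?_
      split_ifs with h
      · have : w q ≤ w i := hw (by simp only [Fin.le_def, q]; omega)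
        nlinarith [hD1 i]
      · have : w i ≤ w q := hw (by simp only [Fin.le_def, q]; omega)
        nlinarith [hD0 i]
    have h2 : (∑ i : Fin d, if d ≤ (i : ℕ) + r then w i else 0) =
        ∑ i : Fin d, (w i - w q) * (if d ≤ (i : ℕ) + r then 1 else 0) + w q * r := by
      rw [← hcard, Finset.mul_sum, ← Finset.sum_add_distrib]
      refine Finset.sum_congr rfl fun i _ => ?_
      split_ifs <;> ring
    have h3 : ∑ i, w i * D i = ∑ i, (w i - w q) * D i + w q * ∑ i, D i := by
      rw [Finset.mul_sum, ← Finset.sum_add_distrib]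
      refine Finset.sum_congr rfl fun i _ => ?_
      ring
    rw [h2, h3]
    exact add_le_add h1 (mul_le_mul_of_nonneg_left hD (hw0 q))
  · refine Finset.sum_le_sum fun i _ => ?_
    rw [if_pos (by omega)]
    exact mul_le_of_le_one_right (hw0 i) (hD1 i)

/-- The square of the distance, in Hilbert-Schmidt norm, of an operator with eigenvalues
`m 0 ≤ … ≤ m (d - 1)` to the non-negative operators of rank at most `r`. -/
def sqDistPos (d r : ℕ) (m : Fin d → ℝ) : ℝ :=
  ∑ i, m i ^ 2 - ∑ i : Fin d, if d ≤ i + r then max (m i) 0 ^ 2 else 0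

section EckartYoung

/-- The squared overlaps `D i j` of the two bases form a doubly stochastic matrix, and the right
side is `∑ D i j (m i - b j)²`. Bounding each square by `sq_sub_ge` where `b j ≠ 0` leaves the gain
`max (m i) 0 ^ 2` weighted by row masses of total at most `r`, to which the bathtub principle
applies. The extra double sum is kept to read off the equality case. -/
theorem sqDistPos_add_le_sum_sq_norm_sub
    (e f : OrthonormalBasis (Fin d) ℂ E) {M : E →ₗ[ℂ] E}
    (hM : M.IsSymmetric) {m b : Fin d → ℝ} (hm : Monotone m)
    (he : ∀ i, M (e i) = (m i : ℂ) • e i) (hb : ∀ i, 0 ≤ b i) {r : ℕ}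
    (hr : (Finset.univ.filter (fun i => b i ≠ 0)).card ≤ r) :
    sqDistPos d r m + ∑ j, ∑ i, (if b j ≠ 0 then
      ‖⟪e i, f j⟫_ℂ‖ ^ 2 * (b j - max (m i) 0) ^ 2 else 0) ≤
      ∑ j, ‖M (f j) - (b j : ℂ) • f j‖ ^ 2 := by
  set D : Fin d → Fin d → ℝ := fun i j => ‖⟪e i, f j⟫_ℂ‖ ^ 2 with hDdef
  have hD0 : ∀ i j, 0 ≤ D i j := fun i j => by positivity
  have hcol : ∀ j, ∑ i, D i j = 1 := fun j => by
    simp only [hDdef]; rw [e.sum_sq_norm_inner_right, f.norm_eq_one, one_pow]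
  have hrow : ∀ i, ∑ j, D i j = 1 := fun i => by
    simp only [hDdef]; rw [f.sum_sq_norm_inner_left, e.norm_eq_one, one_pow]
  have h1 : ∀ j, ‖M (f j) - (b j : ℂ) • f j‖ ^ 2 = ∑ i, D i j * (m i - b j) ^ 2 := fun j => by
    rw [← e.sum_sq_norm_inner_right]
    refine Finset.sum_congr rfl fun i _ => ?_
    rw [inner_sub_right, inner_apply_of_eigenbasis e hM he, inner_smul_right, ← sub_mul, norm_mul,
      mul_pow, mul_comm, ← Complex.ofReal_sub, Complex.norm_real, Real.norm_eq_abs, sq_abs]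
  have h2 : ∑ i, max (m i) 0 ^ 2 * (∑ j, if b j ≠ 0 then D i j else 0) ≤
      ∑ i : Fin d, if d ≤ i + r then max (m i) 0 ^ 2 else 0 := by
    refine sum_mul_le_sum_top ?_ (fun i => sq_nonneg _) (fun i => ?_) (fun i => ?_) ?_
    · intro i j hij
      exact pow_le_pow_left₀ (le_max_right _ _) (max_le_max_right 0 (hm hij)) 2
    · exact Finset.sum_nonneg fun j _ => by split_ifs <;> simp [hD0]
    · rw [← hrow i]
      exact Finset.sum_le_sum fun j _ => by split_ifs <;> simp [hD0]
    · rw [Finset.sum_comm]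
      calc ∑ j, ∑ i, (if b j ≠ 0 then D i j else 0)
          = ∑ j, if b j ≠ 0 then (1 : ℝ) else 0 := by
            refine Finset.sum_congr rfl fun j _ => ?_
            split_ifs
            · exact hcol j
            · simp
        _ = ((Finset.univ.filter (fun i => b i ≠ 0)).card : ℝ) := by rw [Finset.sum_boole]
        _ ≤ r := by exact_mod_cast hr
  have h3 : ∑ i, m i ^ 2 = ∑ j, ∑ i, D i j * m i ^ 2 := by
    rw [Finset.sum_comm]
    refine Finset.sum_congr rfl fun i _ => ?_
    rw [← Finset.sum_mul, hrow, one_mul]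
  have h4 : ∑ i, max (m i) 0 ^ 2 * (∑ j, if b j ≠ 0 then D i j else 0) =
      ∑ j, ∑ i, if b j ≠ 0 then D i j * max (m i) 0 ^ 2 else 0 := by
    rw [Finset.sum_comm]
    refine Finset.sum_congr rfl fun i _ => ?_
    rw [Finset.mul_sum]
    refine Finset.sum_congr rfl fun j _ => ?_
    split_ifs <;> ring
  have h5 : ∑ j, ∑ i, D i j * m i ^ 2 + ∑ j, ∑ i, (if b j ≠ 0 then
      D i j * (b j - max (m i) 0) ^ 2 else 0) ≤
      ∑ j, ∑ i, D i j * (m i - b j) ^ 2 +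
      ∑ j, ∑ i, if b j ≠ 0 then D i j * max (m i) 0 ^ 2 else 0 := by
    simp only [← Finset.sum_add_distrib]
    refine Finset.sum_le_sum fun j _ => Finset.sum_le_sum fun i _ => ?_
    split_ifs with h
    · have := mul_le_mul_of_nonneg_left (sq_sub_ge (m := m i) (hb j)) (hD0 i j)
      linarith
    · rw [not_not.1 h]; simp
  simp only [sqDistPos, h1]
  rw [h4] at h2
  rw [h3]
  linarith

theorem sqDistPos_le_sum_sq_norm_sub
    (e f : OrthonormalBasis (Fin d) ℂ E) {M : E →ₗ[ℂ] E}
    (hM : M.IsSymmetric) {m b : Fin d → ℝ} (hm : Monotone m)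
    (he : ∀ i, M (e i) = (m i : ℂ) • e i) (hb : ∀ i, 0 ≤ b i) {r : ℕ}
    (hr : (Finset.univ.filter (fun i => b i ≠ 0)).card ≤ r) :
    sqDistPos d r m ≤ ∑ j, ‖M (f j) - (b j : ℂ) • f j‖ ^ 2 := by
  refine le_trans (le_add_of_nonneg_right ?_)
    (sqDistPos_add_le_sum_sq_norm_sub e f hM hm he hb hr)
  exact Finset.sum_nonneg fun j _ => Finset.sum_nonneg fun i _ => by split_ifs <;> positivity

/-- At the minimum the extra term vanishes: `f j` overlaps `e i` only if `b j = max (m i) 0`, which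
for `b j ≠ 0` means `m i = b j`. -/
theorem apply_eq_of_sum_sq_norm_sub_le
    (e f : OrthonormalBasis (Fin d) ℂ E) {M : E →ₗ[ℂ] E}
    (hM : M.IsSymmetric) {m b : Fin d → ℝ} (hm : Monotone m)
    (he : ∀ i, M (e i) = (m i : ℂ) • e i) (hb : ∀ i, 0 ≤ b i) {r : ℕ}
    (hr : (Finset.univ.filter (fun i => b i ≠ 0)).card ≤ r)
    (heq : ∑ j, ‖M (f j) - (b j : ℂ) • f j‖ ^ 2 ≤ sqDistPos d r m) (j : Fin d) (hj : b j ≠ 0) :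
    M (f j) = (b j : ℂ) • f j := by
  have h0 := sqDistPos_add_le_sum_sq_norm_sub e f hM hm he hb hr
  have hnn : ∀ j, ∀ i, 0 ≤ (if b j ≠ 0 then
      ‖⟪e i, f j⟫_ℂ‖ ^ 2 * (b j - max (m i) 0) ^ 2 else 0) := fun j i => by
    split_ifs <;> positivity
  have h1 : ∑ j, ∑ i, (if b j ≠ 0 then
      ‖⟪e i, f j⟫_ℂ‖ ^ 2 * (b j - max (m i) 0) ^ 2 else 0) = 0 :=
    le_antisymm (by linarith) (Finset.sum_nonneg fun j _ => Finset.sum_nonneg fun i _ => hnn j i)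
  have h2 := (Finset.sum_eq_zero_iff_of_nonneg
    (fun j _ => Finset.sum_nonneg fun i _ => hnn j i)).1 h1 j (Finset.mem_univ j)
  refine ext_inner_left_basis e.toBasis ?_
  intro i
  have h3 := (Finset.sum_eq_zero_iff_of_nonneg (fun i _ => hnn j i)).1 h2 i (Finset.mem_univ i)
  rw [if_pos hj, mul_eq_zero] at h3
  rw [e.coe_toBasis, inner_apply_of_eigenbasis e hM he, inner_smul_right]
  rcases h3 with h3 | h3
  · have : ⟪e i, f j⟫_ℂ = 0 := by simpa using h3
    rw [this]; simp
  · have h4 : b j = max (m i) 0 := by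
      have := pow_eq_zero_iff (two_ne_zero) |>.1 h3
      linarith
    have h5 : m i = b j := by
      rcases le_total (m i) 0 with h | h
      · rw [max_eq_right h] at h4; exact absurd h4 hj
      · rw [max_eq_left h] at h4; exact h4.symm
    rw [h5]

end EckartYoung

/-- Two commuting symmetric operators have a joint orthonormal eigenbasis. -/
theorem exists_joint_eigenbasis [FiniteDimensional ℂ E] (hd : Module.finrank ℂ E = d)
    {A B : E →ₗ[ℂ] E} (hA : A.IsSymmetric) (hB : B.IsSymmetric) (hAB : Commute A B) :
    ∃ (x : OrthonormalBasis (Fin d) ℂ E) (a b : Fin d → ℝ),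
      (∀ i, A (x i) = (a i : ℂ) • x i) ∧ ∀ i, B (x i) = (b i : ℂ) • x i := by
  classical
  let N : ℂ × ℂ → Submodule ℂ E := fun i =>
    Module.End.eigenspace A i.2 ⊓ Module.End.eigenspace B i.1
  have hint : DirectSum.IsInternal N := hA.directSum_isInternal_of_commute hB hAB
  have hfin : {i | N i ≠ ⊥}.Finite :=
    WellFoundedGT.finite_ne_bot_of_iSupIndep hint.submodule_iSupIndep
  have : Fintype {i // N i ≠ ⊥} := hfin.fintype
  have hint' := DirectSum.isInternal_ne_bot_iff.2 hint
  have horth := (hA.orthogonalFamily_eigenspace_inf_eigenspace hB).comp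
    (Subtype.val_injective (p := fun i => N i ≠ ⊥))
  let x := hint'.subordinateOrthonormalBasis hd horth
  let k := fun i => (hint'.subordinateOrthonormalBasisIndex hd i horth).1
  have hx : ∀ i, x i ∈ N (k i) := fun i =>
    hint'.subordinateOrthonormalBasis_subordinate hd i horth
  have hxA : ∀ i, A (x i) = (k i).2 • x i := fun i => Module.End.mem_eigenspace_iff.1 (hx i).1
  have hxB : ∀ i, B (x i) = (k i).1 • x i := fun i => Module.End.mem_eigenspace_iff.1 (hx i).2
  have hx0 : ∀ i, x i ≠ 0 := fun i h => by simpa [h] using x.norm_eq_one i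
  have hrA : ∀ i, (((k i).2.re : ℝ) : ℂ) = (k i).2 := fun i =>
    Complex.conj_eq_iff_re.1 (hA.conj_eigenvalue_eq_self
      (Module.End.hasEigenvalue_of_hasEigenvector ⟨(hx i).1, hx0 i⟩))
  have hrB : ∀ i, (((k i).1.re : ℝ) : ℂ) = (k i).1 := fun i =>
    Complex.conj_eq_iff_re.1 (hB.conj_eigenvalue_eq_self
      (Module.End.hasEigenvalue_of_hasEigenvector ⟨(hx i).2, hx0 i⟩))
  exact ⟨x, fun i => (k i).2.re, fun i => (k i).1.re, fun i => by rw [hrA, hxA],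
    fun i => by rw [hrB, hxB]⟩

end LinearAlgebra

/-! ### Simultaneous diagonalization at the minimal distance. -/

section JointDiagonalization

variable {E : Type*} [NormedAddCommGroup E] [InnerProductSpace ℂ E] {d : ℕ}

theorem orthonormalBasis_smul_inj (x : OrthonormalBasis (Fin d) ℂ E) {i : Fin d} {a b : ℝ}
    (h : (a : ℂ) • x i = (b : ℂ) • x i) : a = b := by
  have hx : x i ≠ 0 := fun h => by simpa [h] using x.norm_eq_one i
  exact_mod_cast smul_left_injective ℂ hx h

theorem norm_smul_orthonormalBasis_sq (x : OrthonormalBasis (Fin d) ℂ E) (i : Fin d) (a : ℝ) :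
    ‖(a : ℂ) • x i‖ ^ 2 = a ^ 2 := by
  rw [norm_smul, x.norm_eq_one, mul_one, Complex.norm_real, Real.norm_eq_abs, sq_abs]

/-- If the operator `A + B`, with `B` non-negative of rank at most `r`, is as close to `c • 1` as
possible, then `A` and `B` are diagonal in a common orthonormal basis in which their eigenvalues
are oppositely ordered. -/
theorem exists_opposite_eigenbasis {A B : E →ₗ[ℂ] E} (hA : A.IsSymmetric) (hB : B.IsSymmetric)
    (e f g : OrthonormalBasis (Fin d) ℂ E) {α β ν : Fin d → ℝ} (hα : Antitone α) (hβ : Antitone β)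
    (he : ∀ i, A (e i) = (α i : ℂ) • e i) (hf : ∀ i, B (f i) = (β i : ℂ) • f i)
    (hg : ∀ i, (A + B) (g i) = (ν i : ℂ) • g i) (hβ0 : ∀ i, 0 ≤ β i) {r : ℕ}
    (hr : (Finset.univ.filter (fun i => β i ≠ 0)).card ≤ r) {c : ℝ}
    (hc : ∑ i, (c - ν i) ^ 2 ≤ sqDistPos d r (fun i => c - α i)) :
    ∃ x : OrthonormalBasis (Fin d) ℂ E, (∀ i, A (x i) = (α i : ℂ) • x i) ∧
      ∀ i, B (x i) = (β i.rev : ℂ) • x i := by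
  have : FiniteDimensional ℂ E := e.toBasis.finiteDimensional_of_finite
  have hd : Module.finrank ℂ E = d := by
    rw [Module.finrank_eq_card_basis e.toBasis, Fintype.card_fin]
  let I : E →ₗ[ℂ] E := (c : ℂ) • LinearMap.id
  have hIv : ∀ v, I v = (c : ℂ) • v := fun v => rfl
  have hI : I.IsSymmetric := fun v w => by
    rw [hIv, hIv, inner_smul_left, inner_smul_right, Complex.conj_ofReal]
  have hM : (I - A).IsSymmetric := hI.sub hA
  have hN : (I - (A + B)).IsSymmetric := hI.sub (hA.add hB)
  have hm : Monotone fun i => c - α i := fun i j hij => sub_le_sub_left (hα hij) c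
  have heM : ∀ i, (I - A) (e i) = ((c - α i : ℝ) : ℂ) • e i := fun i => by
    rw [LinearMap.sub_apply, hIv, he, ← sub_smul, Complex.ofReal_sub]
  -- The distance may be evaluated in any orthonormal eigenbasis of `B`; this is applied to `f` now
  -- and to the joint eigenbasis below.
  have hsum : ∀ (y : OrthonormalBasis (Fin d) ℂ E) (b : Fin d → ℝ),
      (∀ i, B (y i) = (b i : ℂ) • y i) →
      ∑ j, ‖(I - A) (y j) - (b j : ℂ) • y j‖ ^ 2 ≤ sqDistPos d r (fun i => c - α i) := by
    intro y b hy
    refine le_trans (le_of_eq ?_) hc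
    calc ∑ j, ‖(I - A) (y j) - (b j : ℂ) • y j‖ ^ 2
        = ∑ j, ‖(I - (A + B)) (y j)‖ ^ 2 := by
          refine Finset.sum_congr rfl fun j _ => ?_
          rw [← hy, LinearMap.sub_apply, LinearMap.sub_apply, LinearMap.add_apply, sub_sub]
      _ = ∑ j, ‖(I - (A + B)) (g j)‖ ^ 2 := sum_sq_norm_apply_eq y g hN
      _ = ∑ j, (c - ν j) ^ 2 := by
          refine Finset.sum_congr rfl fun j _ => ?_
          rw [LinearMap.sub_apply, hIv, hg, ← sub_smul, ← Complex.ofReal_sub,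
            norm_smul_orthonormalBasis_sq]
  -- Every `f j` is an eigenvector of `A ∘ B` with real eigenvalue, trivially so when `β j = 0`;
  -- hence `A ∘ B` is symmetric and equals `B ∘ A`.
  have hcomm : Commute A B := by
    have hAf : ∀ j, A (B (f j)) = ((β j * (c - β j) : ℝ) : ℂ) • f j := by
      intro j
      rw [hf, map_smul]
      by_cases hj : β j = 0
      · simp [hj]
      · have h1 := apply_eq_of_sum_sq_norm_sub_le e f hM hm heM hβ0 hr (hsum f β hf) j hj
        rw [LinearMap.sub_apply, hIv, sub_eq_iff_eq_add, ← sub_eq_iff_eq_add', ← sub_smul] at h1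
        rw [← h1, smul_smul]
        push_cast
        rfl
    refine f.toBasis.ext fun j => ?_
    refine ext_inner_left_basis f.toBasis fun k => ?_
    simp only [f.coe_toBasis, Module.End.mul_apply]
    rw [hAf, ← hB, ← hA, hAf, inner_smul_left, inner_smul_right, Complex.conj_ofReal]
    by_cases hjk : k = j
    · rw [hjk]
    · rw [f.inner_eq_zero hjk]; simp
  obtain ⟨x, a, b, hxA, hxB⟩ := exists_joint_eigenbasis hd hA hB hcomm
  have hbβ : b ∘ Tuple.sort (fun i => -b i) = β := by
    refine antitone_eigenvalues_unique (x.reindex (Tuple.sort fun i => -b i).symm) f hB ?_ hβ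
      (fun i => ?_) hf
    · intro i j hij
      have := Tuple.monotone_sort (fun i => -b i) hij
      simpa using this
    · simp [hxB]
  have hbβ' : ∀ i, b i = β ((Tuple.sort fun i => -b i).symm i) := fun i => by
    rw [← hbβ]; simp
  have hcard : ∀ σ : Equiv.Perm (Fin d), (Finset.univ.filter (fun i => b (σ i) ≠ 0)).card ≤ r := by
    intro σ
    refine le_trans (le_of_eq ?_) hr
    refine Finset.card_equiv (σ.trans (Tuple.sort fun i => -b i).symm) fun i => ?_
    simp only [Finset.mem_filter, Finset.mem_univ, true_and, Equiv.trans_apply]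
    rw [hbβ' (σ i)]
  have hb0 : ∀ i, 0 ≤ b i := fun i => by rw [hbβ']; exact hβ0 _
  have hab : ∀ i, b i ≠ 0 → c - a i = b i := by
    intro i hi
    have h1 := apply_eq_of_sum_sq_norm_sub_le e x hM hm heM hb0 (hcard 1) (hsum x b hxB) i hi
    rw [LinearMap.sub_apply, hIv, hxA, ← sub_smul, ← Complex.ofReal_sub] at h1
    exact orthonormalBasis_smul_inj x h1
  -- Exchange argument: otherwise `b j = c - a j > 0` and `b i = 0`, and swapping these two
  -- eigenvalues of `B` keeps the rank but strictly lowers the distance below its minimum.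
  have hanti : ∀ i j, a i < a j → b j ≤ b i := by
    intro i j hij
    by_contra! hlt
    have hj : b j ≠ 0 := (lt_of_le_of_lt (hb0 i) hlt).ne'
    have hj' := hab j hj
    have hi : b i = 0 := by
      by_contra hi
      have := hab i hi
      linarith
    have hne : i ≠ j := fun h => by rw [h] at hij; exact lt_irrefl _ hij
    have h1 := sqDistPos_le_sum_sq_norm_sub e x hM hm heM (b := b ∘ Equiv.swap i j)
      (fun k => hb0 _) (hcard (Equiv.swap i j))
    have h2 := h1.trans' (hsum x b hxB)
    have h3 : ∀ b' : Fin d → ℝ, ∑ k, ‖(I - A) (x k) - (b' k : ℂ) • x k‖ ^ 2 =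
        ∑ k, (c - a k - b' k) ^ 2 := by
      intro b'
      refine Finset.sum_congr rfl fun k _ => ?_
      rw [LinearMap.sub_apply, hIv, hxA, ← sub_smul, ← sub_smul, ← Complex.ofReal_sub,
        ← Complex.ofReal_sub, norm_smul_orthonormalBasis_sq]
    rw [h3, h3, ← sub_nonneg, ← Finset.sum_sub_distrib, Fintype.sum_eq_add i j hne] at h2
    · simp only [Function.comp_apply, Equiv.swap_apply_left, Equiv.swap_apply_right, hi] at h2
      have h4 : 0 < b j := lt_of_le_of_ne (hb0 j) hj.symm
      rw [hj'] at h2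
      nlinarith
    · rintro k ⟨hki, hkj⟩
      simp [Equiv.swap_apply_of_ne_of_ne hki hkj]
  -- Sorting by the difference makes `b` increase and `a` decrease at once, also among ties of
  -- either one.
  let σ := Tuple.sort fun i => b i - a i
  have hσ : Monotone fun i => b (σ i) - a (σ i) := Tuple.monotone_sort fun i => b i - a i
  have hσa : Antitone fun i => a (σ i) := by
    intro i j hij
    by_contra! h
    have h1 := hanti _ _ h
    have h2 := hσ hij
    simp only at h h2
    linarith
  have hσb : Monotone fun i => b (σ i) := by
    intro i j hij
    by_contra! h
    have h2 := hσ hij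
    simp only at h h2
    have h1 := hanti (σ j) (σ i) (by linarith)
    linarith
  have hx' : ∀ i, x.reindex σ.symm i = x (σ i) := fun i => by simp
  refine ⟨x.reindex σ.symm, fun i => ?_, fun i => ?_⟩
  · have : (fun i => a (σ i)) = α :=
      antitone_eigenvalues_unique (x.reindex σ.symm) e hA hσa hα (fun i => by rw [hx', hxA]) he
    rw [hx', hxA, ← this]
  · have : (fun i : Fin d => b (σ i.rev)) = β :=
      antitone_eigenvalues_unique ((x.reindex σ.symm).reindex Fin.revPerm) f hB
        (fun i j hij => hσb (Fin.rev_le_rev.2 hij)) hβ (fun i => by simp [hxB]) hf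
    rw [hx', hxB, ← this]
    simp

end JointDiagonalization

/-! ### Order properties of the sorted water-filling. -/

section WaterFilling

variable {d : ℕ}

theorem antitone_sortDesc (v : Fin d → ℝ) : Antitone (sortDesc v) := fun i j hij => by
  simpa [sortDesc] using Tuple.monotone_sort (fun i => -v i) hij

theorem sum_comp_sortDesc (v : Fin d → ℝ) (φ : ℝ → ℝ) :
    ∑ i, φ (sortDesc v i) = ∑ i, φ (v i) :=
  Equiv.sum_comp (Tuple.sort fun i => -v i) fun i => φ (v i)

/-- The unsorted water-filling: the last `r` entries of `α` are raised to the level `c`. -/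
def raiseLast (r : ℕ) (c : ℝ) (α : Fin d → ℝ) (j : Fin d) : ℝ :=
  if d ≤ j + r then max (α j) c else α j

variable {r : ℕ} {c : ℝ} {α : Fin d → ℝ}

theorem le_raiseLast (j : Fin d) : α j ≤ raiseLast r c α j := by
  unfold raiseLast; split_ifs
  · exact le_max_left _ _
  · exact le_rfl

theorem raiseLast_eq_of_lt {j : Fin d} (h : c < raiseLast r c α j) : raiseLast r c α j = α j := by
  unfold raiseLast at *; split_ifs at *
  · rcases lt_max_iff.1 h with h | h
    · exact max_eq_left h.le
    · exact absurd h (lt_irrefl _)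
  · rfl

/-- Entries above `c` are original ones. If the claim failed, the `i + 1` sorted entries up to
position `i` would all come from values exceeding `α i`, but only the `i` indices before `i` can
carry those. -/
theorem sortDesc_raiseLast_le (hα : Antitone α) {i : Fin d}
    (h : c < sortDesc (raiseLast r c α) i) : sortDesc (raiseLast r c α) i ≤ α i := by
  set v := raiseLast r c α
  set σ := Tuple.sort fun i => -v i
  by_contra! hlt
  have h1 : (Finset.Iic i).card ≤ (Finset.Iio i).card := by
    refine Finset.card_le_card_of_injOn σ (fun k hk => ?_) σ.injective.injOn
    have hk' : k ≤ i := by simpa using hk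
    have h2 : sortDesc v i ≤ v (σ k) := antitone_sortDesc v hk'
    have h3 : v (σ k) = α (σ k) := raiseLast_eq_of_lt (h.trans_le h2)
    have h4 : α i < α (σ k) := by rw [← h3]; exact hlt.trans_le h2
    simpa using hα.reflect_lt h4
  rw [Fin.card_Iic, Fin.card_Iio] at h1
  omega

/-- Entries below `c` come from the first `d - r` indices, so the `d - i` sorted positions from `i`
on inject there; hence `r ≤ i`. If `α (i - r)` were too large, they would inject into only `d - i -
1` indices. -/
theorem exists_le_sortDesc_raiseLast (hα : Antitone α) {i : Fin d}
    (h : sortDesc (raiseLast r c α) i < c) :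
    ∃ j : Fin d, (i : ℕ) = j + r ∧ α j ≤ sortDesc (raiseLast r c α) i := by
  set v := raiseLast r c α with hv
  set σ := Tuple.sort fun i => -v i
  have key : ∀ k, i ≤ k → (σ k : ℕ) + r < d ∧ α (σ k) ≤ sortDesc v i := by
    intro k hk
    have h2 : v (σ k) ≤ sortDesc v i := antitone_sortDesc v hk
    refine ⟨?_, (le_raiseLast _).trans h2⟩
    by_contra! hd
    have h3 : c ≤ v (σ k) := by
      rw [hv, raiseLast, if_pos hd]; exact le_max_right _ _
    linarith
  have hinj : ∀ s : Finset (Fin d), Set.InjOn (fun k => (σ k : ℕ)) s := fun s =>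
    (Fin.val_injective.comp σ.injective).injOn
  have hi : r ≤ i := by
    have h1 : (Finset.Ici i).card ≤ (Finset.range (d - r)).card := by
      refine Finset.card_le_card_of_injOn (fun k => (σ k : ℕ)) (fun k hk => ?_) (hinj _)
      have := (key k (by simpa using hk)).1
      simp only [Finset.coe_range, Set.mem_Iio]
      omega
    rw [Fin.card_Ici, Finset.card_range] at h1
    have := (key i le_rfl).1
    omega
  refine ⟨⟨i - r, by omega⟩, by simp; omega, ?_⟩
  by_contra! hlt
  have h1 : (Finset.Ici i).card ≤ (Finset.Ico (i - r + 1) (d - r)).card := by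
    refine Finset.card_le_card_of_injOn (fun k => (σ k : ℕ)) (fun k hk => ?_) (hinj _)
    have hk' := key k (by simpa using hk)
    have h2 := hα.reflect_lt (hk'.2.trans_lt hlt)
    rw [Fin.lt_def] at h2
    simp only [Finset.coe_Ico, Set.mem_Ico]
    simp only at h2
    omega
  rw [Fin.card_Ici, Nat.card_Ico] at h1
  omega

/-- Identifies the minimal distance from `c • 1 - A` with the deviation of the water-filling from
its level; this is where the two parts of the argument meet. -/
theorem sqDistPos_sub_eq :
    sqDistPos d r (fun i => c - α i) = ∑ i, (c - raiseLast r c α i) ^ 2 := by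
  rw [sqDistPos, ← Finset.sum_sub_distrib]
  refine Finset.sum_congr rfl fun i _ => ?_
  unfold raiseLast
  split_ifs
  · rcases le_total (α i) c with h | h
    · rw [max_eq_left (by linarith), max_eq_right h]; ring
    · rw [max_eq_right (by linarith), max_eq_left h]; ring
  · ring

end WaterFilling

/-! ### Subgradient comparison of convex sums. -/

section Convex

variable {h : ℝ → ℝ}

theorem subgradient_le (hh : ConvexOn ℝ (Set.Ici 0) h) {x y : ℝ} (hx : 0 < x) (hy : 0 ≤ y) :
    h x + derivWithin h (Set.Ioi x) x * (y - x) ≤ h y := by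
  have hxi : x ∈ interior (Set.Ici (0 : ℝ)) := by rw [interior_Ici]; exact hx
  rcases lt_trichotomy x y with hxy | rfl | hxy
  · have h1 := hh.rightDeriv_le_slope_of_mem_interior hxi hy hxy
    rw [slope_def_field, le_div_iff₀ (by linarith)] at h1
    linarith
  · simp
  · have h1 := (hh.slope_le_leftDeriv_of_mem_interior hy hxi hxy).trans
      (hh.leftDeriv_le_rightDeriv_of_mem_interior hxi)
    rw [slope_def_field, div_le_iff₀ (by linarith)] at h1
    linarith

theorem subgradient_lt (hh : StrictConvexOn ℝ (Set.Ici 0) h) {x y : ℝ} (hx : 0 < x) (hy : 0 ≤ y)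
    (hxy : x ≠ y) : h x + derivWithin h (Set.Ioi x) x * (y - x) < h y := by
  have h1 := hh.2 (Set.mem_Ici.2 hx.le) (Set.mem_Ici.2 hy) hxy (one_half_pos (α := ℝ))
    one_half_pos (add_halves 1)
  simp only [smul_eq_mul] at h1
  -- The weak inequality at the midpoint, combined with strict convexity there, gives the strict one
  -- at `y`.
  have h2 := subgradient_le hh.convexOn hx (y := 1 / 2 * x + 1 / 2 * y) (by positivity)
  nlinarith

variable {ι : Type*} [Fintype ι] {μ ν : ι → ℝ} {c : ℝ}

/-- Right derivatives increase, and `μ i - ν i` has the sign of `ν i - c` or vanishes when `ν i ≠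
c`; so each slope can be replaced by the one at `c`, which is non-negative by monotonicity of `h`.
-/
theorem sum_subgradient_nonneg (hh : ConvexOn ℝ (Set.Ici 0) h) (hmono : MonotoneOn h (Set.Ici 0))
    (hν : ∀ i, 0 < ν i) (hc : 0 < c) (hsum : ∑ i, ν i ≤ ∑ i, μ i)
    (h1 : ∀ i, c < ν i → ν i ≤ μ i) (h2 : ∀ i, ν i < c → μ i ≤ ν i) :
    0 ≤ ∑ i, derivWithin h (Set.Ioi (ν i)) (ν i) * (μ i - ν i) := by
  have hs0 : 0 ≤ derivWithin h (Set.Ioi c) c := by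
    have h3 := subgradient_le hh hc (le_refl 0)
    have h4 := hmono Set.self_mem_Ici hc.le hc.le
    by_contra! h5
    nlinarith
  have hsm : MonotoneOn (fun x => derivWithin h (Set.Ioi x) x) (Set.Ioi 0) := by
    simpa [interior_Ici] using hh.monotoneOn_rightDeriv
  calc (0 : ℝ) ≤ derivWithin h (Set.Ioi c) c * ∑ i, (μ i - ν i) :=
        mul_nonneg hs0 (by rw [Finset.sum_sub_distrib]; linarith)
    _ = ∑ i, derivWithin h (Set.Ioi c) c * (μ i - ν i) := Finset.mul_sum _ _ _
    _ ≤ _ := by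
        refine Finset.sum_le_sum fun i _ => ?_
        rcases lt_trichotomy c (ν i) with hi | hi | hi
        · exact mul_le_mul_of_nonneg_right (hsm hc (hν i) hi.le) (sub_nonneg.2 (h1 i hi))
        · rw [← hi]
        · exact mul_le_mul_of_nonpos_right (hsm (hν i) hc hi.le) (sub_nonpos.2 (h2 i hi))

theorem sum_convex_le (hh : ConvexOn ℝ (Set.Ici 0) h) (hmono : MonotoneOn h (Set.Ici 0))
    (hμ : ∀ i, 0 ≤ μ i) (hν : ∀ i, 0 < ν i) (hc : 0 < c) (hsum : ∑ i, ν i ≤ ∑ i, μ i)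
    (h1 : ∀ i, c < ν i → ν i ≤ μ i) (h2 : ∀ i, ν i < c → μ i ≤ ν i) :
    ∑ i, h (ν i) ≤ ∑ i, h (μ i) := by
  have h3 := sum_subgradient_nonneg hh hmono hν hc hsum h1 h2
  have h4 := Finset.sum_le_sum fun i (_ : i ∈ Finset.univ) => subgradient_le hh (hν i) (hμ i)
  rw [Finset.sum_add_distrib] at h4
  linarith

theorem eq_of_sum_convex_eq (hh : StrictConvexOn ℝ (Set.Ici 0) h)
    (hmono : MonotoneOn h (Set.Ici 0))
    (hμ : ∀ i, 0 ≤ μ i) (hν : ∀ i, 0 < ν i) (hc : 0 < c) (hsum : ∑ i, ν i ≤ ∑ i, μ i)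
    (h1 : ∀ i, c < ν i → ν i ≤ μ i) (h2 : ∀ i, ν i < c → μ i ≤ ν i)
    (heq : ∑ i, h (ν i) = ∑ i, h (μ i)) : μ = ν := by
  by_contra hne
  obtain ⟨j, hj⟩ := Function.ne_iff.1 hne
  have h3 := sum_subgradient_nonneg hh.convexOn hmono hν hc hsum h1 h2
  have h4 := Finset.sum_lt_sum
    (fun i (_ : i ∈ Finset.univ) => subgradient_le hh.convexOn (hν i) (hμ i))
    ⟨j, Finset.mem_univ j, subgradient_lt hh (hν j) (hμ j) (Ne.symm hj)⟩
  rw [Finset.sum_add_distrib] at h4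
  linarith

end Convex

/-! ### Existence and uniqueness of the water level. -/

section WaterLevel

variable {l : ℕ → ℝ} {d : ℕ} {p : ℕ}

theorem exists_water_level (hl : ∀ i < d, l (d - 1) ≤ l i) (hp : p < d) {τ : ℝ} (hτ : 0 ≤ τ) :
    ∃ c, l (d - 1) ≤ c ∧ ∑ i ∈ Finset.Ico p d, max (c - l i) 0 = τ := by
  have hcont : Continuous fun c : ℝ => ∑ i ∈ Finset.Ico p d, max (c - l i) 0 := by fun_prop
  have h0 : ∑ i ∈ Finset.Ico p d, max (l (d - 1) - l i) 0 = 0 := by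
    refine Finset.sum_eq_zero fun i hi => max_eq_right ?_
    have := hl i (Finset.mem_Ico.1 hi).2
    linarith
  -- The last term alone already contributes `τ`, which supplies the upper end for the intermediate
  -- value theorem.
  have h1 : τ ≤ ∑ i ∈ Finset.Ico p d, max (l (d - 1) + τ - l i) 0 := by
    have := Finset.single_le_sum (f := fun i => max (l (d - 1) + τ - l i) 0)
      (fun i _ => le_max_right _ _) (Finset.mem_Ico.2 ⟨by omega, by omega⟩ : d - 1 ∈ Finset.Ico p d)
    refine le_trans ?_ this
    simp
  obtain ⟨c, hc, hc'⟩ := intermediate_value_Icc (by linarith : l (d - 1) ≤ l (d - 1) + τ)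
    hcont.continuousOn ⟨h0.trans_le hτ, h1⟩
  exact ⟨c, hc.1, hc'⟩

theorem water_level_unique (hp : p < d) {c c' : ℝ} (hc : l (d - 1) ≤ c) (hc' : l (d - 1) ≤ c')
    (h : ∑ i ∈ Finset.Ico p d, max (c - l i) 0 = ∑ i ∈ Finset.Ico p d, max (c' - l i) 0) :
    c = c' := by
  have key : ∀ {x y : ℝ}, l (d - 1) ≤ x → x < y →
      ∑ i ∈ Finset.Ico p d, max (x - l i) 0 < ∑ i ∈ Finset.Ico p d, max (y - l i) 0 := by
    intro x y hx hxy
    refine Finset.sum_lt_sum (fun i _ => max_le_max_right 0 (by linarith))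
      ⟨d - 1, Finset.mem_Ico.2 ⟨by omega, by omega⟩, ?_⟩
    rw [max_eq_left (by linarith), max_eq_left (by linarith)]
    linarith
  rcases lt_trichotomy c c' with h1 | h1 | h1
  · exact absurd h (key hc h1).ne
  · exact h1
  · exact absurd h (key hc' h1).ne'

end WaterLevel

/-! ### Synthesis, analysis and frame operators. -/

section Synthesis

variable {H : Type*} [NormedAddCommGroup H] [InnerProductSpace ℂ H] {n : ℕ}

theorem synthesis_apply (F : Fin n → H) (a : EuclideanSpace ℂ (Fin n)) :
    synthesis F a = ∑ i, a i • F i := by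
  simp [synthesis]

theorem synthesis_add (F G : Fin n → H) : synthesis (F + G) = synthesis F + synthesis G := by
  ext a
  simp [synthesis_apply, Finset.sum_add_distrib]

theorem synthesis_single (F : Fin n → H) (i : Fin n) :
    synthesis F (EuclideanSpace.single i 1) = F i := by
  simp [synthesis_apply, ite_smul]

theorem synthesis_of_apply_single (T : EuclideanSpace ℂ (Fin n) →L[ℂ] H) :
    synthesis (fun i => T (EuclideanSpace.single i 1)) = T := by
  refine ContinuousLinearMap.coe_injective
    ((EuclideanSpace.basisFun (Fin n) ℂ).toBasis.ext fun i => ?_)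
  simp [synthesis_apply, ite_smul]

theorem synthesis_mem {V : Submodule ℂ H} {F : Fin n → H} (hF : ∀ i, F i ∈ V)
    (a : EuclideanSpace ℂ (Fin n)) : synthesis F a ∈ V := by
  rw [synthesis_apply]
  exact V.sum_mem fun i _ => V.smul_mem _ (hF i)

variable [CompleteSpace H]

theorem inner_synthesis (F : Fin n → H) (a : EuclideanSpace ℂ (Fin n)) (x : H) :
    ⟪synthesis F a, x⟫_ℂ = ⟪a, analysis F x⟫_ℂ :=
  (ContinuousLinearMap.adjoint_inner_right _ _ _).symm

theorem analysis_apply (F : Fin n → H) (x : H) (i : Fin n) : analysis F x i = ⟪F i, x⟫_ℂ := by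
  have h := inner_synthesis F (EuclideanSpace.single i 1) x
  rw [synthesis_single, EuclideanSpace.inner_single_left, map_one, one_mul] at h
  exact h.symm

theorem analysis_eq_zero_iff {F : Fin n → H} {x : H} :
    analysis F x = 0 ↔ ∀ i, ⟪F i, x⟫_ℂ = 0 := by
  simp_rw [← analysis_apply]
  exact ⟨fun h i => by rw [h]; rfl, fun h => by ext i; exact h i⟩

theorem norm_analysis_sq (F : Fin n → H) (x : H) :
    ‖analysis F x‖ ^ 2 = ∑ i, ‖⟪F i, x⟫_ℂ‖ ^ 2 := by
  simp_rw [EuclideanSpace.norm_sq_eq, analysis_apply]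

theorem inner_frameOp (F : Fin n → H) (x : H) : (⟪x, frameOp F x⟫_ℂ).re = ‖analysis F x‖ ^ 2 := by
  rw [← inner_conj_symm, Complex.conj_re]
  change (⟪synthesis F (analysis F x), x⟫_ℂ).re = _
  rw [inner_synthesis]
  exact inner_self_eq_norm_sq (𝕜 := ℂ) _

theorem frameOp_mem {V : Submodule ℂ H} {F : Fin n → H} (hF : ∀ i, F i ∈ V) (x : H) :
    frameOp F x ∈ V :=
  synthesis_mem hF _

/-- The hypothesis kills one cross term, and its adjoint kills the other. -/
theorem frameOp_add {F G : Fin n → H} (h : ∀ x, synthesis G (analysis F x) = 0) :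
    frameOp (F + G) = frameOp F + frameOp G := by
  have h1 : synthesis G ∘L analysis F = 0 := ContinuousLinearMap.ext h
  have h2 : synthesis F ∘L analysis G = 0 := by
    have := congrArg ContinuousLinearMap.adjoint h1
    rwa [ContinuousLinearMap.adjoint_comp, analysis, ContinuousLinearMap.adjoint_adjoint,
      map_zero] at this
  have h3 : analysis (F + G) = analysis F + analysis G := by
    rw [analysis, synthesis_add, map_add]; rfl
  rw [frameOp, h3, synthesis_add, ContinuousLinearMap.comp_add, ContinuousLinearMap.add_comp,
    ContinuousLinearMap.add_comp, h1, h2, add_zero, zero_add]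
  rfl

/-- If the coefficients killed by `synthesis F` are killed by `synthesis G`, then the range of
`analysis G` is contained in that of `analysis F`. -/
theorem exists_analysis_eq {F G : Fin n → H} (h : ∀ a, synthesis F a = 0 → synthesis G a = 0)
    (x : H) : ∃ y, analysis F y = analysis G x := by
  set R := LinearMap.range (analysis F : H →ₗ[ℂ] EuclideanSpace ℂ (Fin n))
  suffices hx : analysis G x ∈ Rᗮᗮ by
    rw [Submodule.orthogonal_orthogonal] at hx
    exact hx
  rw [Submodule.mem_orthogonal]
  intro a ha
  rw [← inner_synthesis, h a, inner_zero_left]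
  rw [← inner_self_eq_zero (𝕜 := ℂ), inner_synthesis]
  exact Submodule.inner_left_of_mem_orthogonal (K := R) ⟨_, rfl⟩ ha

end Synthesis

/-! ### Eigenvalues of compressions to a subspace. -/

section Compression

variable {H : Type*} [NormedAddCommGroup H] [InnerProductSpace ℂ H] {V : Submodule ℂ H}
  {T : H →L[ℂ] H}

theorem coe_compression_apply [FiniteDimensional ℂ V] (hV : ∀ x, T x ∈ V) (x : V) :
    (compression V T x : H) = T x :=
  congrArg Subtype.val (V.orthogonalProjectionOnto_mem_subspace_eq_self ⟨T x, hV x⟩)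

variable [CompleteSpace H]

theorem eq_sum_rankOne (hT : IsSelfAdjoint T) (hV : ∀ x, T x ∈ V) {d : ℕ}
    (x : OrthonormalBasis (Fin d) ℂ V) {β : Fin d → ℝ}
    (hx : ∀ i, T (x i : H) = (β i : ℂ) • (x i : H)) :
    T = ∑ i, (β i : ℂ) • rankOne ℂ (x i : H) (x i : H) := by
  have hsym : ∀ y z, ⟪T y, z⟫_ℂ = ⟪y, T z⟫_ℂ := hT.isSymmetric
  ext y
  have h1 := x.sum_repr' ⟨T y, hV y⟩
  have h2 := congrArg (Subtype.val) h1
  simp only [Submodule.coe_sum, Submodule.coe_smul, Submodule.coe_inner] at h2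
  rw [← h2, sum_apply]
  refine Finset.sum_congr rfl fun i _ => ?_
  rw [← hsym, hx, inner_smul_left, Complex.conj_ofReal, smul_apply,
    rankOne_apply, smul_smul]

variable [FiniteDimensional ℂ V]

theorem exists_eigenbasis_compression (hT : IsSelfAdjoint T) {d : ℕ}
    (hd : Module.finrank ℂ V = d) :
    ∃ e : OrthonormalBasis (Fin d) ℂ V, ∀ i : Fin d,
      (compression V T : V →ₗ[ℂ] V) (e i) = (eigenvalueSeq V hT i : ℂ) • e i := by
  subst hd
  refine ⟨(compression_isSymmetric V hT).eigenvectorBasis rfl, fun i => ?_⟩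
  rw [(compression_isSymmetric V hT).apply_eigenvectorBasis, eigenvalueSeq, dif_pos i.2]
  rfl

theorem antitone_eigenvalueSeq (hT : IsSelfAdjoint T) {d : ℕ} (hd : Module.finrank ℂ V = d) :
    Antitone fun i : Fin d => eigenvalueSeq V hT i := by
  subst hd
  intro i j hij
  simp only [eigenvalueSeq, Fin.is_lt, dif_pos]
  exact (compression_isSymmetric V hT).eigenvalues_antitone rfl hij

theorem eigenvalueSeq_eq_zero (hT : IsSelfAdjoint T) {d : ℕ} (hd : Module.finrank ℂ V = d)
    {i : ℕ} (hi : d ≤ i) : eigenvalueSeq V hT i = 0 := by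
  rw [eigenvalueSeq, dif_neg (by omega)]

theorem eigenvalueSeq_congr {U U' : Submodule ℂ H} [FiniteDimensional ℂ U]
    [FiniteDimensional ℂ U'] (h : U = U') (hT : IsSelfAdjoint T) :
    eigenvalueSeq U hT = eigenvalueSeq U' hT := by
  subst h; rfl

theorem eigenvalueSeq_eq_of_eigenbasis (hT : IsSelfAdjoint T) (hV : ∀ x, T x ∈ V) {d : ℕ}
    (x : OrthonormalBasis (Fin d) ℂ V) {β : Fin d → ℝ} (hβ : Antitone β)
    (hx : ∀ i, T (x i : H) = (β i : ℂ) • (x i : H)) (i : Fin d) : eigenvalueSeq V hT i = β i := by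
  have hd : Module.finrank ℂ V = d := by
    rw [Module.finrank_eq_card_basis x.toBasis, Fintype.card_fin]
  obtain ⟨e, he⟩ := exists_eigenbasis_compression hT hd
  refine congrFun (antitone_eigenvalues_unique e x (compression_isSymmetric V hT)
    (antitone_eigenvalueSeq hT hd) hβ he fun j => Subtype.ext ?_) i
  exact (coe_compression_apply hV _).trans (hx j)

/-- Each eigenvalue is `∑ j, |⟨G j, e i⟩|²`; summing over `i` first is Parseval. This turns the norm
constraint on duals into a trace constraint. -/
theorem sum_eigenvalueSeq_frameOp {n : ℕ} {G : Fin n → H} (hG : ∀ i, G i ∈ V) {d : ℕ}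
    (hd : Module.finrank ℂ V = d) :
    ∑ i : Fin d, eigenvalueSeq V (frameOp_isSelfAdjoint G) i = ∑ i, ‖G i‖ ^ 2 := by
  obtain ⟨e, he⟩ := exists_eigenbasis_compression (frameOp_isSelfAdjoint G) hd
  have h1 : ∀ i : Fin d, eigenvalueSeq V (frameOp_isSelfAdjoint G) i =
      ∑ j, ‖⟪(⟨G j, hG j⟩ : V), e i⟫_ℂ‖ ^ 2 := by
    intro i
    have h2 := congrArg Subtype.val (he i)
    have h3 := (coe_compression_apply (frameOp_mem hG) (e i)).symm.trans h2
    have h4 := inner_frameOp G (e i)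
    rw [norm_analysis_sq, h3, Submodule.coe_smul, ← Submodule.coe_smul, ← Submodule.coe_inner,
      inner_smul_right, inner_self_eq_norm_sq_to_K, e.norm_eq_one] at h4
    simpa using h4
  simp_rw [h1]
  rw [Finset.sum_comm]
  refine Finset.sum_congr rfl fun j _ => ?_
  rw [e.sum_sq_norm_inner_left]
  rfl

end Compression

/-! ### Nonzero eigenvalues and rank. -/

section Rank

variable {E : Type*} [NormedAddCommGroup E] [InnerProductSpace ℂ E] {d : ℕ}

theorem card_eigenvalue_ne_zero_le (f : OrthonormalBasis (Fin d) ℂ E) {B : E →ₗ[ℂ] E}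
    {β : Fin d → ℝ} (hf : ∀ i, B (f i) = (β i : ℂ) • f i) :
    (Finset.univ.filter (fun i => β i ≠ 0)).card ≤ Module.finrank ℂ (LinearMap.range B) := by
  have : FiniteDimensional ℂ E := f.toBasis.finiteDimensional_of_finite
  have hmem : ∀ i : {i // β i ≠ 0}, f i ∈ LinearMap.range B := fun i =>
    ⟨((β i : ℂ)⁻¹) • f i, by
      rw [map_smul, hf, smul_smul, inv_mul_cancel₀ (by exact_mod_cast i.2), one_smul]⟩
  have hli : LinearIndependent ℂ fun i : {i // β i ≠ 0} => (⟨f i, hmem i⟩ : LinearMap.range B) := by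
    refine LinearIndependent.of_comp (LinearMap.range B).subtype ?_
    exact f.orthonormal.linearIndependent.comp _ Subtype.val_injective
  have := hli.fintype_card_le_finrank
  rwa [Fintype.card_subtype] at this

end Rank

/-! ### Frames, oblique duals and the canonical dual. -/

section Frame

variable {H : Type*} [NormedAddCommGroup H] [InnerProductSpace ℂ H] [CompleteSpace H] {n : ℕ}
  {V W : Submodule ℂ H} {F : Fin n → H}

theorem IsFrameFor.analysis_eq_zero_iff [FiniteDimensional ℂ W] (hF : IsFrameFor W F) {x : H} :
    analysis F x = 0 ↔ x ∈ Wᗮ := by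
  obtain ⟨hFW, A, B, hA, -, hAB⟩ := hF
  constructor
  · intro hx
    have hsub : x - W.starProjection x ∈ Wᗮ := W.sub_starProjection_mem_orthogonal x
    have h1 : analysis F (W.starProjection x) = 0 := by
      rw [ObliqueDual.analysis_eq_zero_iff] at hx ⊢
      intro i
      have h2 : ⟪F i, x - W.starProjection x⟫_ℂ = 0 :=
        Submodule.inner_right_of_mem_orthogonal (hFW i) hsub
      rw [inner_sub_right, hx, zero_sub, neg_eq_zero] at h2
      exact h2
    have h2 := (hAB (W.starProjection x) (W.starProjection_apply_mem x)).1
    have h3 : ∑ i, ‖⟪W.starProjection x, F i⟫_ℂ‖ ^ 2 = 0 := by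
      refine Finset.sum_eq_zero fun i _ => ?_
      rw [norm_inner_symm, ObliqueDual.analysis_eq_zero_iff.1 h1 i]; simp
    rw [h3] at h2
    have h4 : ‖W.starProjection x‖ ^ 2 ≤ 0 := by
      by_contra! h
      nlinarith
    have h5 : W.starProjection x = 0 := by simpa using h4
    rwa [h5, sub_zero] at hsub
  · intro hx
    rw [ObliqueDual.analysis_eq_zero_iff]
    exact fun i => Submodule.inner_right_of_mem_orthogonal (hFW i) hx

theorem IsObliqueDual.span_eq {G : Fin n → H} (hG : IsObliqueDual V F G) :
    Submodule.span ℂ (Set.range G) = V := by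
  refine le_antisymm (Submodule.span_le.2 ?_) fun g hg => ?_
  · rintro _ ⟨i, rfl⟩
    exact hG.1 i
  · rw [← hG.2 g hg]
    exact synthesis_mem (fun i => Submodule.subset_span (Set.mem_range_self i)) _

theorem IsObliqueDual.frameSpectrum_eq [FiniteDimensional ℂ V] {G : Fin n → H}
    (hG : IsObliqueDual V F G) : frameSpectrum G = eigenvalueSeq V (frameOp_isSelfAdjoint G) :=
  eigenvalueSeq_congr hG.span_eq _

/-- A zero eigenvalue would give a unit vector of `V` orthogonal to `span G = V`. Positivity keeps
the subgradients at interior points of `[0, ∞)`. -/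
theorem IsObliqueDual.eigenvalueSeq_pos [FiniteDimensional ℂ V] {G : Fin n → H}
    (hG : IsObliqueDual V F G) {d : ℕ} (hd : Module.finrank ℂ V = d) (i : Fin d) :
    0 < eigenvalueSeq V (frameOp_isSelfAdjoint G) i := by
  obtain ⟨e, he⟩ := exists_eigenbasis_compression (frameOp_isSelfAdjoint G) hd
  have h2 := congrArg Subtype.val (he i)
  have h3 := (coe_compression_apply (frameOp_mem hG.1) (e i)).symm.trans h2
  have h4 := inner_frameOp G (e i)
  rw [h3, ← Submodule.coe_inner, inner_smul_right, inner_self_eq_norm_sq_to_K,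
    e.norm_eq_one] at h4
  have h5 : eigenvalueSeq V (frameOp_isSelfAdjoint G) i = ‖analysis G (e i)‖ ^ 2 := by
    simpa using h4
  rw [h5]
  have h6 : analysis G (e i : H) ≠ 0 := by
    intro h0
    have h7 : (e i : H) ∈ (Submodule.span ℂ (Set.range G))ᗮ := by
      rw [Submodule.mem_orthogonal]
      intro u hu
      induction hu using Submodule.span_induction with
      | mem u hu =>
        obtain ⟨j, rfl⟩ := hu
        exact ObliqueDual.analysis_eq_zero_iff.1 h0 j
      | zero => exact inner_zero_left _
      | add u v _ _ hu hv => rw [inner_add_left, hu, hv, add_zero]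
      | smul a u _ hu => rw [inner_smul_left, hu, mul_zero]
    rw [hG.span_eq] at h7
    have h8 : ⟪(e i : H), (e i : H)⟫_ℂ = 0 := Submodule.inner_right_of_mem_orthogonal (e i).2 h7
    have h9 : e i = 0 := Subtype.ext (inner_self_eq_zero.1 h8)
    have h10 := e.norm_eq_one i
    rw [h9, norm_zero] at h10
    exact zero_ne_one h10
  positivity

theorem synthesis_canonicalDual (hVW : IsCompl V Wᗮ) (a : EuclideanSpace ℂ (Fin n)) :
    synthesis (canonicalDual hVW F) a =
      V.projection Wᗮ hVW (moorePenrose (frameOp F) (synthesis F a)) := by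
  simp only [synthesis_apply, canonicalDual, map_sum, map_smul]

theorem isObliqueDual_canonicalDual (hVW : IsCompl V Wᗮ) [FiniteDimensional ℂ W]
    (hF : IsFrameFor W F) :
    IsObliqueDual V F (canonicalDual hVW F) := by
  refine ⟨fun i => Submodule.projection_apply_mem _ _, fun g hg => ?_⟩
  have hfin : FiniteDimensional ℂ (LinearMap.range (frameOp F : H →ₗ[ℂ] H)) := by
    refine Submodule.finiteDimensional_of_le (S₂ := W) ?_
    rintro _ ⟨x, rfl⟩
    exact frameOp_mem hF.1 x
  have hX : IsMoorePenrose (frameOp F) (moorePenrose (frameOp F)) := by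
    have hex := exists_isMoorePenrose (frameOp_isSelfAdjoint F)
    rw [moorePenrose, dif_pos hex]
    exact hex.choose_spec
  rw [synthesis_canonicalDual]
  change V.projection Wᗮ hVW (moorePenrose (frameOp F) (frameOp F g)) = g
  set z := moorePenrose (frameOp F) (frameOp F g) with hz
  have h1 : frameOp F z = frameOp F g := DFunLike.congr_fun hX.mul_mul_left g
  -- The first Penrose equation puts `z - g` in the kernel of the frame operator, which is `Wᗮ`, the
  -- kernel of the oblique projection.
  have h2 : z - g ∈ Wᗮ := by
    rw [← hF.analysis_eq_zero_iff, ← norm_eq_zero, ← sq_eq_zero_iff, ← inner_frameOp, map_sub, h1,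
      sub_self, inner_zero_right, Complex.zero_re]
  have h3 := (Submodule.projection_apply_eq_zero_iff hVW).2 h2
  rw [map_sub, sub_eq_zero] at h3
  rw [h3]
  exact Submodule.projection_apply_left hVW ⟨g, hg⟩

theorem synthesis_analysis_eq_zero (hVW : IsCompl V Wᗮ) [FiniteDimensional ℂ W]
    (hF : IsFrameFor W F)
    {Y : Fin n → H} (hY : ∀ g ∈ V, synthesis Y (analysis F g) = 0) (x : H) :
    synthesis Y (analysis F x) = 0 := by
  have h1 := hF.analysis_eq_zero_iff.2 (Submodule.sub_projection_mem hVW x)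
  rw [map_sub, sub_eq_zero] at h1
  rw [h1]
  exact hY _ (Submodule.projection_apply_mem _ _)

theorem frameOp_canonicalDual_add (hVW : IsCompl V Wᗮ) [FiniteDimensional ℂ W]
    (hF : IsFrameFor W F)
    {Y : Fin n → H} (hY : ∀ g ∈ V, synthesis Y (analysis F g) = 0) :
    frameOp (canonicalDual hVW F + Y) = frameOp (canonicalDual hVW F) + frameOp Y := by
  refine frameOp_add fun x => ?_
  obtain ⟨y, hy⟩ := exists_analysis_eq (F := F) (G := canonicalDual hVW F)
    (fun a ha => by rw [synthesis_canonicalDual, ha, map_zero, map_zero]) x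
  rw [← hy]
  exact synthesis_analysis_eq_zero hVW hF hY y

theorem finrank_map_analysis (hVW : IsCompl V Wᗮ) [FiniteDimensional ℂ W] (hF : IsFrameFor W F) :
    Module.finrank ℂ (V.map (analysis F : H →ₗ[ℂ] EuclideanSpace ℂ (Fin n))) =
      Module.finrank ℂ V := by
  have hinj : Function.Injective ((analysis F : H →ₗ[ℂ] EuclideanSpace ℂ (Fin n)).domRestrict V) := by
    rw [injective_iff_map_eq_zero]
    intro x hx
    have h1 : (x : H) ∈ Wᗮ := hF.analysis_eq_zero_iff.1 hx
    exact Subtype.ext (Submodule.disjoint_def.1 hVW.disjoint _ x.2 h1)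
  rw [← LinearMap.finrank_range_of_inj hinj, LinearMap.range_domRestrict]

/-- Rank-nullity for `synthesis Y`, whose kernel contains the image of `V` under the injective
restriction of `analysis F`. -/
theorem finrank_range_compression_frameOp_le (hVW : IsCompl V Wᗮ) [FiniteDimensional ℂ V]
    [FiniteDimensional ℂ W]
    (hF : IsFrameFor W F) {Y : Fin n → H} (hYV : ∀ i, Y i ∈ V)
    (hY : ∀ g ∈ V, synthesis Y (analysis F g) = 0) :
    Module.finrank ℂ (LinearMap.range (compression V (frameOp Y) : V →ₗ[ℂ] V)) +
      Module.finrank ℂ V ≤ n := by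
  let T : EuclideanSpace ℂ (Fin n) →ₗ[ℂ] H := synthesis Y
  have h1 : V.map (analysis F : H →ₗ[ℂ] EuclideanSpace ℂ (Fin n)) ≤ LinearMap.ker T := by
    rintro _ ⟨g, hg, rfl⟩
    exact hY g hg
  have h2 := Submodule.finrank_mono h1
  rw [finrank_map_analysis hVW hF] at h2
  have h3 := LinearMap.finrank_range_add_finrank_ker T
  rw [finrank_euclideanSpace_fin] at h3
  have h4 : (LinearMap.range (compression V (frameOp Y) : V →ₗ[ℂ] V)).map V.subtype ≤
      LinearMap.range T := by
    rintro _ ⟨_, ⟨x, rfl⟩, rfl⟩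
    exact ⟨analysis Y x, (coe_compression_apply (frameOp_mem hYV) x).symm⟩
  have h5 := Submodule.finrank_mono h4
  rw [Submodule.finrank_map_subtype_eq] at h5
  omega

/-- A non-negative operator on `V` of rank at most the dimension of `Rᗮ` is the frame operator of
a family whose synthesis operator vanishes on `R`. -/
theorem exists_family_frameOp_eq {d r : ℕ} (x : OrthonormalBasis (Fin d) ℂ V)
    {γ : Fin d → ℝ} (hγ : ∀ i, 0 ≤ γ i) (R : Submodule ℂ (EuclideanSpace ℂ (Fin n)))
    (hR : Module.finrank ℂ Rᗮ = r) (hγr : ∀ i : Fin d, γ i ≠ 0 → d ≤ i + r) :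
    ∃ Y : Fin n → H, (∀ i, Y i ∈ V) ∧ (∀ a ∈ R, synthesis Y a = 0) ∧
      ∀ i, frameOp Y (x i) = (γ i : ℂ) • (x i : H) := by
  subst hR
  let u := stdOrthonormalBasis ℂ Rᗮ
  -- Numbering by `i.rev` assigns the orthonormal vectors of `Rᗮ` to the last indices, the only ones
  -- where `γ` may be nonzero; the default `0` is harmless elsewhere.
  let w : Fin d → EuclideanSpace ℂ (Fin n) := fun i =>
    if h : (i.rev : ℕ) < Module.finrank ℂ Rᗮ then (u ⟨i.rev, h⟩ : EuclideanSpace ℂ (Fin n)) else 0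
  have hwR : ∀ i, w i ∈ Rᗮ := fun i => by
    simp only [w]; split_ifs
    · exact (u _).2
    · exact Submodule.zero_mem _
  have hw0 : ∀ i j, i ≠ j → ⟪w i, w j⟫_ℂ = 0 := fun i j hij => by
    simp only [w]; split_ifs
    · rw [← Submodule.coe_inner]
      refine u.inner_eq_zero fun h => hij ?_
      exact Fin.rev_injective (Fin.ext (Fin.mk.inj h))
    all_goals simp
  have hw1 : ∀ i, (γ i : ℂ) * ⟪w i, w i⟫_ℂ = γ i := fun i => by
    by_cases hi : γ i = 0
    · simp [hi]
    · have h := hγr i hi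
      have h' : (i.rev : ℕ) < Module.finrank ℂ Rᗮ := by rw [Fin.val_rev]; omega
      simp only [w, dif_pos h']
      rw [← Submodule.coe_inner, inner_self_eq_norm_sq_to_K, u.norm_eq_one]
      simp
  -- A square-root factorization: `T T†` has eigenvalues `γ i` on the `x i`, and `T` vanishes on
  -- `R`.
  let T : EuclideanSpace ℂ (Fin n) →L[ℂ] H :=
    ∑ i, ((Real.sqrt (γ i) : ℝ) : ℂ) • rankOne ℂ (x i : H) (w i)
  have hT : ∀ a, T a = ∑ i, ((Real.sqrt (γ i) : ℝ) : ℂ) • ⟪w i, a⟫_ℂ • (x i : H) := fun a => by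
    simp [T]
  have hsyn := synthesis_of_apply_single T
  have hxx : ∀ i k, i ≠ k → ⟪(x i : H), (x k : H)⟫_ℂ = 0 := fun i k hik => by
    rw [← Submodule.coe_inner]; exact x.inner_eq_zero hik
  have hx1 : ∀ k, ⟪(x k : H), (x k : H)⟫_ℂ = 1 := fun k => by
    rw [← Submodule.coe_inner, inner_self_eq_norm_sq_to_K, x.norm_eq_one]; simp
  refine ⟨fun i => T (EuclideanSpace.single i 1), fun i => ?_, fun a ha => ?_, fun k => ?_⟩
  · simp only [hT]
    exact V.sum_mem fun i _ => V.smul_mem _ (V.smul_mem _ (x i).2)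
  · rw [hsyn, hT]
    refine Finset.sum_eq_zero fun i _ => ?_
    rw [Submodule.inner_left_of_mem_orthogonal ha (hwR i), zero_smul, smul_zero]
  · have h1 : analysis (fun i => T (EuclideanSpace.single i 1)) (x k) =
        ((Real.sqrt (γ k) : ℝ) : ℂ) • w k := by
      refine ext_inner_left ℂ fun a => ?_
      rw [← inner_synthesis, hsyn, hT, sum_inner, Finset.sum_eq_single k]
      · rw [inner_smul_left, inner_smul_left, hx1, Complex.conj_ofReal, inner_conj_symm, mul_one,
          inner_smul_right]
      · intro i _ hik
        rw [inner_smul_left, inner_smul_left, hxx i k hik, mul_zero, mul_zero]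
      · simp
    change synthesis _ (analysis _ _) = _
    rw [h1, hsyn, map_smul, hT, Finset.sum_eq_single k]
    · rw [smul_smul, smul_smul, ← Complex.ofReal_mul, Real.mul_self_sqrt (hγ k), hw1]
    · intro i _ hik
      rw [hw0 i k hik, zero_smul, smul_zero]
    · simp

end Frame

/-! ### Spectra of oblique duals. -/

section Duals

variable {H : Type*} [NormedAddCommGroup H] [InnerProductSpace ℂ H] [CompleteSpace H] {n d : ℕ}
  {V W : Submodule ℂ H} [FiniteDimensional ℂ W] {F G : Fin n → H}

theorem IsFrameFor.finrank_le (hVW : IsCompl V Wᗮ) (hF : IsFrameFor W F) :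
    Module.finrank ℂ V ≤ n := by
  rw [← finrank_map_analysis hVW hF]
  exact (Submodule.finrank_le _).trans finrank_euclideanSpace_fin.le

theorem IsObliqueDual.synthesis_sub_analysis (hVW : IsCompl V Wᗮ) (hF : IsFrameFor W F)
    (hG : IsObliqueDual V F G) {g : H} (hg : g ∈ V) :
    synthesis (G - canonicalDual hVW F) (analysis F g) = 0 := by
  have h1 := synthesis_add (canonicalDual hVW F) (G - canonicalDual hVW F)
  rw [add_sub_cancel] at h1
  have h2 := hG.2 g hg
  rw [h1, add_apply, (isObliqueDual_canonicalDual hVW hF).2 g hg] at h2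
  exact add_eq_left.1 h2

theorem IsObliqueDual.frameOp_sub (hVW : IsCompl V Wᗮ) (hF : IsFrameFor W F)
    (hG : IsObliqueDual V F G) :
    frameOp G - frameOp (canonicalDual hVW F) = frameOp (G - canonicalDual hVW F) := by
  have h := frameOp_canonicalDual_add hVW hF
    (fun g hg => hG.synthesis_sub_analysis hVW hF hg)
  rw [add_sub_cancel] at h
  rw [h, add_sub_cancel_left]

theorem IsObliqueDual.sub_mem (hVW : IsCompl V Wᗮ) (hF : IsFrameFor W F)
    (hG : IsObliqueDual V F G) (i : Fin n) : (G - canonicalDual hVW F) i ∈ V :=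
  V.sub_mem (hG.1 i) ((isObliqueDual_canonicalDual hVW hF).1 i)

theorem IsObliqueDual.inner_sub (hVW : IsCompl V Wᗮ) (hF : IsFrameFor W F)
    (hG : IsObliqueDual V F G) (x : H) :
    (⟪x, (frameOp G - frameOp (canonicalDual hVW F)) x⟫_ℂ).re =
      ‖analysis (G - canonicalDual hVW F) x‖ ^ 2 := by
  rw [hG.frameOp_sub hVW hF, inner_frameOp]

theorem IsObliqueDual.convexPotential_eq (hG : IsObliqueDual V F G)
    (hd : Module.finrank ℂ V = d) (h : ℝ → ℝ) :
    convexPotential h G = ∑ i : Fin d, h (frameSpectrum G i) := by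
  rw [convexPotential, hG.span_eq, hd, Finset.sum_range]

variable [FiniteDimensional ℂ V]

theorem IsObliqueDual.finrank_range_le (hVW : IsCompl V Wᗮ) (hF : IsFrameFor W F)
    (hG : IsObliqueDual V F G) :
    Module.finrank ℂ (LinearMap.range (compression V
      (frameOp G - frameOp (canonicalDual hVW F)) : V →ₗ[ℂ] V)) + Module.finrank ℂ V ≤ n := by
  rw [hG.frameOp_sub hVW hF]
  exact finrank_range_compression_frameOp_le hVW hF (hG.sub_mem hVW hF)
    (fun g hg => hG.synthesis_sub_analysis hVW hF hg)

theorem IsObliqueDual.canonical_eigenvalue_le (hVW : IsCompl V Wᗮ) (hF : IsFrameFor W F)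
    (hG : IsObliqueDual V F G) (hd : Module.finrank ℂ V = d) (i : Fin d) :
    eigenvalueSeq V (frameOp_isSelfAdjoint (canonicalDual hVW F)) i ≤
      eigenvalueSeq V (frameOp_isSelfAdjoint G) i := by
  obtain ⟨e, he⟩ := exists_eigenbasis_compression
    (frameOp_isSelfAdjoint (canonicalDual hVW F)) hd
  obtain ⟨g, hg⟩ := exists_eigenbasis_compression (frameOp_isSelfAdjoint G) hd
  refine eigenvalue_le_of_le_on e g (compression_isSymmetric V (frameOp_isSelfAdjoint _))
    (compression_isSymmetric V (frameOp_isSelfAdjoint G)) (antitone_eigenvalueSeq _ hd)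
    (antitone_eigenvalueSeq _ hd) he hg ⊤ (r := 0) (by rw [finrank_top, hd]; rfl) (fun x _ => ?_) rfl
  have h := hG.inner_sub hVW hF x
  rw [sub_apply, inner_sub_right, Complex.sub_re] at h
  change (⟪(x : H), (compression V _ x : H)⟫_ℂ).re ≤ (⟪(x : H), (compression V _ x : H)⟫_ℂ).re
  rw [coe_compression_apply (frameOp_mem hG.1), coe_compression_apply
    (frameOp_mem (isObliqueDual_canonicalDual hVW hF).1)]
  have := sq_nonneg ‖analysis (G - canonicalDual hVW F) (x : H)‖
  linarith

theorem IsObliqueDual.eigenvalue_le_canonical (hVW : IsCompl V Wᗮ) (hF : IsFrameFor W F)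
    (hG : IsObliqueDual V F G) (hd : Module.finrank ℂ V = d) {i j : Fin d}
    (hij : (i : ℕ) = j + (n - d)) :
    eigenvalueSeq V (frameOp_isSelfAdjoint G) i ≤
      eigenvalueSeq V (frameOp_isSelfAdjoint (canonicalDual hVW F)) j := by
  obtain ⟨e, he⟩ := exists_eigenbasis_compression
    (frameOp_isSelfAdjoint (canonicalDual hVW F)) hd
  obtain ⟨g, hg⟩ := exists_eigenbasis_compression (frameOp_isSelfAdjoint G) hd
  set B : V →ₗ[ℂ] V :=
    ((compression V (frameOp G - frameOp (canonicalDual hVW F)) : V →L[ℂ] V) : V →ₗ[ℂ] V) with hB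
  have hrk : Module.finrank ℂ (LinearMap.range B) + Module.finrank ℂ V ≤ n :=
    hG.finrank_range_le hVW hF
  have hker := LinearMap.finrank_range_add_finrank_ker B
  -- On the kernel of the perturbation, of codimension at most `n - d`, the two quadratic forms
  -- coincide.
  refine eigenvalue_le_of_le_on g e (compression_isSymmetric V (frameOp_isSelfAdjoint G))
    (compression_isSymmetric V (frameOp_isSelfAdjoint _)) (antitone_eigenvalueSeq _ hd)
    (antitone_eigenvalueSeq _ hd) hg he (LinearMap.ker B) (r := n - d) (by omega)
    (fun x hx => ?_) hij
  have h1 : B x = compression V (frameOp G) x - compression V (frameOp (canonicalDual hVW F)) x := by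
    simp [hB, compression]
  rw [LinearMap.mem_ker.1 hx] at h1
  change (⟪x, compression V _ x⟫_ℂ).re ≤ (⟪x, compression V _ x⟫_ℂ).re
  rw [sub_eq_zero.1 h1.symm]

theorem IsObliqueDual.frameSpectrum_eq_zero (hG : IsObliqueDual V F G)
    (hd : Module.finrank ℂ V = d) {i : ℕ} (hi : d ≤ i) : frameSpectrum G i = 0 := by
  rw [hG.frameSpectrum_eq]
  exact eigenvalueSeq_eq_zero _ hd hi

/-- An oblique dual whose spectrum is obtained from the canonical one by adding non-negative
numbers to the last `n - d` entries. -/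
theorem exists_isObliqueDual_frameSpectrum_eq (hVW : IsCompl V Wᗮ) (hF : IsFrameFor W F)
    (hd : Module.finrank ℂ V = d) {v : Fin d → ℝ}
    (hv : ∀ i : Fin d, canonicalSpectrum hVW F i ≤ v i)
    (hv' : ∀ i : Fin d, v i ≠ canonicalSpectrum hVW F i → d ≤ i + (n - d)) :
    ∃ G, IsObliqueDual V F G ∧ ∀ i : Fin d, frameSpectrum G i = sortDesc v i := by
  have hcan := isObliqueDual_canonicalDual hVW hF
  obtain ⟨e, he⟩ := exists_eigenbasis_compression
    (frameOp_isSelfAdjoint (canonicalDual hVW F)) hd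
  have he' : ∀ i, frameOp (canonicalDual hVW F) (e i) =
      (canonicalSpectrum hVW F i : ℂ) • (e i : H) := fun i => by
    have h := congrArg Subtype.val (he i)
    rw [canonicalSpectrum, hcan.frameSpectrum_eq]
    exact (coe_compression_apply (frameOp_mem hcan.1) (e i)).symm.trans h
  have hR : Module.finrank ℂ
      (V.map (analysis F : H →ₗ[ℂ] EuclideanSpace ℂ (Fin n)))ᗮ = n - d := by
    have h1 := Submodule.finrank_add_finrank_orthogonal
      (V.map (analysis F : H →ₗ[ℂ] EuclideanSpace ℂ (Fin n)))
    rw [finrank_map_analysis hVW hF, finrank_euclideanSpace_fin] at h1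
    omega
  obtain ⟨Y, hYV, hYR, hY⟩ := exists_family_frameOp_eq e
    (γ := fun i => v i - canonicalSpectrum hVW F i) (fun i => sub_nonneg.2 (hv i)) _ hR
    (fun i hi => hv' i (sub_ne_zero.1 hi))
  have hYF : ∀ g ∈ V, synthesis Y (analysis F g) = 0 := fun g hg => hYR _ ⟨g, hg, rfl⟩
  have hG : IsObliqueDual V F (canonicalDual hVW F + Y) := by
    refine ⟨fun i => V.add_mem (hcan.1 i) (hYV i), fun g hg => ?_⟩
    rw [synthesis_add, add_apply, hcan.2 g hg, hYF g hg, add_zero]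
  refine ⟨_, hG, fun i => ?_⟩
  rw [hG.frameSpectrum_eq]
  refine eigenvalueSeq_eq_of_eigenbasis _ (frameOp_mem hG.1)
    (e.reindex (Tuple.sort fun i => -v i).symm) (antitone_sortDesc v) (fun k => ?_) i
  rw [frameOp_canonicalDual_add hVW hF hYF, add_apply, OrthonormalBasis.reindex_apply,
    Equiv.symm_symm, he', hY, ← add_smul, ← Complex.ofReal_add, add_sub_cancel]
  rfl

/-- An oblique dual of minimal potential differs from the canonical one by an operator that is
diagonal in an eigenbasis of the latter, with oppositely ordered eigenvalues. -/
theorem IsObliqueDual.exists_opposite_eigenbasis (hVW : IsCompl V Wᗮ) (hF : IsFrameFor W F)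
    (hG : IsObliqueDual V F G) (hd : Module.finrank ℂ V = d) {c : ℝ}
    (hspec : ∀ i : Fin d, frameSpectrum G i =
      sortDesc (raiseLast (n - d) c fun j : Fin d => canonicalSpectrum hVW F j) i) :
    ∃ x : OrthonormalBasis (Fin d) ℂ V,
      frameOp (canonicalDual hVW F) = ∑ i : Fin d, ((canonicalSpectrum hVW F i : ℝ) : ℂ) •
        rankOne ℂ (x i : H) (x i : H) ∧
      frameOp G - frameOp (canonicalDual hVW F) =
        ∑ i : Fin d, ((eigenvalueSeq V ((frameOp_isSelfAdjoint G).sub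
          (frameOp_isSelfAdjoint (canonicalDual hVW F))) (i.rev : ℕ) : ℝ) : ℂ) •
          rankOne ℂ (x i : H) (x i : H) := by
  have hcan := isObliqueDual_canonicalDual hVW hF
  have hsa := (frameOp_isSelfAdjoint G).sub (frameOp_isSelfAdjoint (canonicalDual hVW F))
  have hmem : ∀ x, (frameOp G - frameOp (canonicalDual hVW F)) x ∈ V := fun x =>
    V.sub_mem (frameOp_mem hG.1 x) (frameOp_mem hcan.1 x)
  obtain ⟨e, he⟩ := exists_eigenbasis_compression
    (frameOp_isSelfAdjoint (canonicalDual hVW F)) hd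
  obtain ⟨f, hf⟩ := exists_eigenbasis_compression hsa hd
  obtain ⟨g, hg⟩ := exists_eigenbasis_compression (frameOp_isSelfAdjoint G) hd
  have hadd : (compression V (frameOp (canonicalDual hVW F)) : V →ₗ[ℂ] V) +
      (compression V (frameOp G - frameOp (canonicalDual hVW F)) : V →ₗ[ℂ] V) =
      (compression V (frameOp G) : V →ₗ[ℂ] V) := by
    ext x
    simp [compression]
  have hβ0 : ∀ i : Fin d, 0 ≤ eigenvalueSeq V hsa i := by
    intro i
    have h1 := congrArg Subtype.val (hf i)
    have h2 := (coe_compression_apply hmem (f i)).symm.trans h1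
    have h3 := hG.inner_sub hVW hF (f i)
    rw [h2, ← Submodule.coe_inner, inner_smul_right, inner_self_eq_norm_sq_to_K,
      f.norm_eq_one] at h3
    have h4 : eigenvalueSeq V hsa i = ‖analysis (G - canonicalDual hVW F) (f i)‖ ^ 2 := by
      simpa using h3
    rw [h4]
    positivity
  have hrk := hG.finrank_range_le hVW hF
  obtain ⟨x, hxA, hxB⟩ := ObliqueDual.exists_opposite_eigenbasis
    (compression_isSymmetric V (frameOp_isSelfAdjoint (canonicalDual hVW F)))
    (compression_isSymmetric V hsa) e f g (antitone_eigenvalueSeq _ hd)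
    (antitone_eigenvalueSeq hsa hd) he hf (by rw [hadd]; exact hg) hβ0 (r := n - d)
    ((card_eigenvalue_ne_zero_le f hf).trans (by omega)) (c := c) (by
      rw [canonicalSpectrum, hcan.frameSpectrum_eq, hG.frameSpectrum_eq] at hspec
      simp_rw [hspec]
      rw [sqDistPos_sub_eq]
      exact (sum_comp_sortDesc _ fun y => (c - y) ^ 2).le)
  refine ⟨x, eq_sum_rankOne (frameOp_isSelfAdjoint _) (frameOp_mem hcan.1) x fun i => ?_,
    eq_sum_rankOne hsa hmem x fun i => ?_⟩
  · rw [canonicalSpectrum, hcan.frameSpectrum_eq]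
    exact (coe_compression_apply (frameOp_mem hcan.1) (x i)).symm.trans
      (congrArg Subtype.val (hxA i))
  · exact (coe_compression_apply hmem (x i)).symm.trans (congrArg Subtype.val (hxB i))

end Duals

/-! ### Sequences versus vectors of length `d`. -/

section Sequences

theorem seqTrace_eq_sum {l : ℕ → ℝ} {d : ℕ} (hl : ∀ i, d ≤ i → l i = 0) :
    seqTrace l = ∑ i : Fin d, l i := by
  rw [seqTrace, tsum_eq_sum (s := Finset.range d) fun i hi => hl i (by simpa using hi),
    Finset.sum_range]

theorem waterFilling_of_lt {l : ℕ → ℝ} {d n : ℕ} (hdn : d ≤ n) (c : ℝ) (i : Fin d) :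
    waterFilling l d (2 * (d : ℤ) - n) c i =
      sortDesc (raiseLast (n - d) c fun j : Fin d => l j) i := by
  rw [waterFilling, dif_pos i.2]
  congr 2
  funext j
  unfold raiseLast
  by_cases h : d ≤ j + (n - d)
  · rw [if_neg (by omega), if_pos h]
    rcases le_total c (l j) with h | h
    · rw [max_eq_right (by linarith), max_eq_left h, zero_add]
    · rw [max_eq_left (by linarith), max_eq_right h, sub_add_cancel]
  · rw [if_pos (by omega), if_neg h]

theorem waterFilling_eq_zero {l : ℕ → ℝ} {d : ℕ} {m : ℤ} {c : ℝ} {i : ℕ} (hi : d ≤ i) :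
    waterFilling l d m c i = 0 := by
  rw [waterFilling, dif_neg (by omega)]

theorem sum_raiseLast {l : ℕ → ℝ} {d n : ℕ} (hdn : d ≤ n) (c : ℝ) :
    ∑ i : Fin d, raiseLast (n - d) c (fun j : Fin d => l j) i = ∑ i : Fin d, l i +
      ∑ i ∈ Finset.Ico (max (2 * (d : ℤ) - n) 0).toNat d, max (c - l i) 0 := by
  -- With zero-based indices and `d ≤ n`, being past the first `max m 0` entries means being among
  -- the last `n - d`.
  have h : Finset.Ico (max (2 * (d : ℤ) - n) 0).toNat d =
      (Finset.range d).filter fun i => d ≤ i + (n - d) := by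
    ext i
    simp only [Finset.mem_Ico, Finset.mem_filter, Finset.mem_range]
    omega
  rw [h, Finset.sum_filter, Finset.sum_range, ← Finset.sum_add_distrib]
  refine Finset.sum_congr rfl fun i _ => ?_
  simp only [raiseLast]
  split_ifs
  · rcases le_total c (l i) with h | h
    · rw [max_eq_left h, max_eq_right (by linarith), add_zero]
    · rw [max_eq_right h, max_eq_left (by linarith), add_sub_cancel]
  · rw [add_zero]

theorem exists_isWaterLevel {l : ℕ → ℝ} {d n : ℕ} {t : ℝ} (hdn : d ≤ n)
    (hl : ∀ i < d, l (d - 1) ≤ l i) (hl0 : ∀ i < d, 0 < l i) (ht : seqTrace l ≤ t)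
    (hcase : (0 < d ∧ d < n) ∨ t = seqTrace l) :
    ∃ c, 0 < c ∧ IsWaterLevel l d (2 * (d : ℤ) - n) t c := by
  by_cases h : 0 < d ∧ d < n
  · obtain ⟨c, hc, hc'⟩ := exists_water_level hl
      (p := (max (2 * (d : ℤ) - n) 0).toNat) (by omega) (sub_nonneg.2 ht)
    exact ⟨c, (hl0 (d - 1) (by omega)).trans_le hc, hc, hc'⟩
  -- Nothing can be raised when `d = 0` or `d = n`, so any level above `l (d - 1)` works; the `1`
  -- makes it positive even for `d = 0`.
  · refine ⟨max (l (d - 1)) 1, by positivity, le_max_left _ _, ?_⟩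
    rw [hcase.resolve_left h, sub_self, Finset.Ico_eq_empty (by omega), Finset.sum_empty]

theorem IsWaterLevel.unique {l : ℕ → ℝ} {d n : ℕ} {t c c' : ℝ} (hd : 0 < d) (hdn : d < n)
    (hc : IsWaterLevel l d (2 * (d : ℤ) - n) t c)
    (hc' : IsWaterLevel l d (2 * (d : ℤ) - n) t c') : c' = c :=
  water_level_unique (p := (max (2 * (d : ℤ) - n) 0).toNat) (by omega) hc'.1 hc.1
    (hc'.2.trans hc.2.symm)

theorem isSummableDecreasing_of_antitone {H : Type*} [NormedAddCommGroup H]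
    [InnerProductSpace ℂ H] {V : Submodule ℂ H} [FiniteDimensional ℂ V] {d : ℕ}
    (hd : Module.finrank ℂ V = d) {x : ℕ → ℝ} (hx : Antitone fun i : Fin d => x i)
    (hx0 : ∀ i : Fin d, 0 ≤ x i) (hxd : ∀ i, d ≤ i → x i = 0) : IsSummableDecreasing H x := by
  have hnn : ∀ i, 0 ≤ x i := fun i => by
    rcases lt_or_ge i d with h | h
    · exact hx0 ⟨i, h⟩
    · exact (hxd i h).ge
  refine ⟨fun i j hij => ?_, hnn, ?_, fun i hi => hxd i ?_⟩
  · rcases lt_or_ge j d with h | h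
    · exact hx (a := ⟨i, hij.trans_lt h⟩) (b := ⟨j, h⟩) hij
    · rw [hxd j h]; exact hnn i
  · exact summable_of_ne_finset_zero (s := Finset.range d) fun i hi => hxd i (by simpa using hi)
  · have h := (Submodule.rank_le V).trans hi
    rw [← Module.finrank_eq_rank, hd] at h
    exact_mod_cast h

end Sequences

end ObliqueDual

end

/-! ### The main theorem. -/

theorem theorem3p8 {H : Type*} [NormedAddCommGroup H] [InnerProductSpace ℂ H] [CompleteSpace H]
    (V W : Submodule ℂ H) [FiniteDimensional ℂ V] [FiniteDimensional ℂ W]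
    (hVW : IsCompl V Wᗮ) (d n : ℕ) (hdV : Module.finrank ℂ V = d) (hdW : Module.finrank ℂ W = d)
    (F : Fin n → H) (hF : ObliqueDual.IsFrameFor W F) (t : ℝ)
    (ht : ObliqueDual.seqTrace
      (ObliqueDual.canonicalSpectrum hVW F) ≤ t)
    (hdn : (0 < d ∧ d < n) ∨ t = ObliqueDual.seqTrace
      (ObliqueDual.canonicalSpectrum hVW F)) :
    ∃ (c : ℝ) (ν : ℕ → ℝ),
      ObliqueDual.IsWaterLevel (ObliqueDual.canonicalSpectrum hVW F) d
        (2 * (d : ℤ) - (n : ℤ)) t c ∧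
      (0 < d → d < n → ∀ c' : ℝ,
        ObliqueDual.IsWaterLevel (ObliqueDual.canonicalSpectrum hVW F) d
          (2 * (d : ℤ) - (n : ℤ)) t c' → c' = c) ∧
      ν = ObliqueDual.waterFilling (ObliqueDual.canonicalSpectrum hVW F) d
        (2 * (d : ℤ) - (n : ℤ)) c ∧
      ObliqueDual.IsSummableDecreasing H ν ∧
      ∃ Gop ∈ ObliqueDual.dualsAbove V t F,
        ObliqueDual.frameSpectrum Gop = ν ∧
        (∀ h : ℝ → ℝ, ObliqueDual.IsConvexPotentialFun h → MonotoneOn h (Set.Ici 0) →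
          ∀ G ∈ ObliqueDual.dualsAbove V t F,
            ObliqueDual.convexPotential h Gop ≤ ObliqueDual.convexPotential h G) ∧
        (∀ h : ℝ → ℝ, ObliqueDual.IsConvexPotentialFun h → MonotoneOn h (Set.Ici 0) →
          StrictConvexOn ℝ (Set.Ici 0) h →
          ∀ G ∈ ObliqueDual.dualsAbove V t F,
            ObliqueDual.convexPotential h Gop = ObliqueDual.convexPotential h G →
            ObliqueDual.frameSpectrum G = ν ∧
            ∃ x : OrthonormalBasis (Fin d) ℂ V,
              ObliqueDual.frameOp (ObliqueDual.canonicalDual hVW F) =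
                ∑ i : Fin d, ((ObliqueDual.canonicalSpectrum hVW F i : ℝ) : ℂ) •
                  InnerProductSpace.rankOne ℂ (x i : H) (x i : H) ∧
              ObliqueDual.frameOp G - ObliqueDual.frameOp (ObliqueDual.canonicalDual hVW F) =
                ∑ i : Fin d, ((ObliqueDual.eigenvalueSeq V
                    ((ObliqueDual.frameOp_isSelfAdjoint G).sub
                      (ObliqueDual.frameOp_isSelfAdjoint (ObliqueDual.canonicalDual hVW F)))
                    (i.rev : ℕ) : ℝ) : ℂ) •
                  InnerProductSpace.rankOne ℂ (x i : H) (x i : H)) := by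
  open ObliqueDual in
  have hcan := isObliqueDual_canonicalDual hVW hF
  have hn : d ≤ n := hdV ▸ hF.finrank_le hVW
  set l := canonicalSpectrum hVW F with hl
  set α : Fin d → ℝ := fun j => l j with hα
  have hlV : l = eigenvalueSeq V (frameOp_isSelfAdjoint (canonicalDual hVW F)) :=
    hcan.frameSpectrum_eq
  have hαanti : Antitone α := by
    simp only [hα, hlV]; exact antitone_eigenvalueSeq _ hdV
  have hαpos : ∀ i, 0 < α i := fun i => by
    simp only [hα, hlV]; exact hcan.eigenvalueSeq_pos hdV i
  have hltrace : seqTrace l = ∑ i, α i :=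
    seqTrace_eq_sum fun i hi => hcan.frameSpectrum_eq_zero hdV hi
  obtain ⟨c, hc0, hc⟩ := exists_isWaterLevel hn
    (fun i hi => hαanti (a := ⟨i, hi⟩) (b := ⟨d - 1, by omega⟩) (by rw [Fin.le_def]; simp; omega))
    (fun i hi => hαpos ⟨i, hi⟩) ht hdn
  set v := raiseLast (n - d) c α with hv
  have hν : ∀ i : Fin d, waterFilling l d (2 * (d : ℤ) - n) c i = sortDesc v i :=
    waterFilling_of_lt hn c
  have hvpos : ∀ i, 0 < sortDesc v i := fun i => (hαpos _).trans_le (le_raiseLast _)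
  have hvsum : ∑ i, sortDesc v i = t := by
    rw [sum_comp_sortDesc v fun y => y, hv, hα, sum_raiseLast hn, hc.2, hltrace]
    exact add_sub_cancel _ _
  obtain ⟨Gop, hGop, hGopν⟩ := exists_isObliqueDual_frameSpectrum_eq hVW hF hdV (v := v)
    le_raiseLast (fun i hi => by
      by_contra h
      exact hi (if_neg h))
  have htrace : ∀ {G : Fin n → H}, IsObliqueDual V F G →
      ∑ i, ‖G i‖ ^ 2 = ∑ i : Fin d, frameSpectrum G i := fun hG => by
    rw [hG.frameSpectrum_eq, sum_eigenvalueSeq_frameOp hG.1 hdV]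
  -- This bound and the next combine the pigeonhole lemmas with the two Weyl inequalities, through
  -- `α i` here and through `α (i - r)`, with `r = n - d`, below the level.
  have hup : ∀ {G : Fin n → H}, IsObliqueDual V F G → ∀ i, c < sortDesc v i →
      sortDesc v i ≤ frameSpectrum G i := fun {G} hG i hi => by
    refine (sortDesc_raiseLast_le hαanti hi).trans ?_
    simp only [hα, hlV, hG.frameSpectrum_eq]
    exact hG.canonical_eigenvalue_le hVW hF hdV i
  have hdown : ∀ {G : Fin n → H}, IsObliqueDual V F G → ∀ i, sortDesc v i < c →
      frameSpectrum G i ≤ sortDesc v i := fun {G} hG i hi => by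
    obtain ⟨j, hij, hj⟩ := exists_le_sortDesc_raiseLast hαanti hi
    refine le_trans ?_ hj
    simp only [hα, hlV, hG.frameSpectrum_eq]
    exact hG.eigenvalue_le_canonical hVW hF hdV hij
  have hpos : ∀ {G : Fin n → H}, IsObliqueDual V F G → ∀ i : Fin d, 0 ≤ frameSpectrum G i :=
    fun hG i => by
      rw [hG.frameSpectrum_eq]
      exact (hG.eigenvalueSeq_pos hdV i).le
  have hsum : ∀ {G : Fin n → H}, G ∈ dualsAbove V t F →
      ∑ i, sortDesc v i ≤ ∑ i : Fin d, frameSpectrum G i := fun hG => by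
    rw [hvsum, ← htrace hG.1]
    exact hG.2
  have hspec : ∀ {G : Fin n → H}, IsObliqueDual V F G →
      (∀ i : Fin d, frameSpectrum G i = sortDesc v i) →
      frameSpectrum G = waterFilling l d (2 * (d : ℤ) - n) c := fun hG h => by
    funext i
    rcases lt_or_ge i d with hi | hi
    · exact (h ⟨i, hi⟩).trans (hν ⟨i, hi⟩).symm
    · rw [hG.frameSpectrum_eq_zero hdV hi, waterFilling_eq_zero hi]
  refine ⟨c, _, hc, fun h1 h2 c' hc' => hc.unique h1 h2 hc', rfl,
    isSummableDecreasing_of_antitone hdV ?_ ?_ fun i hi => waterFilling_eq_zero hi,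
    Gop, ⟨hGop, ?_⟩, hspec hGop hGopν, ?_, ?_⟩
  · simp only [hν]; exact antitone_sortDesc v
  · intro i; rw [hν]; exact (hvpos i).le
  · rw [htrace hGop]; simp only [hGopν, hvsum, le_refl]
  · intro h hh hmono G hG
    rw [hGop.convexPotential_eq hdV, hG.1.convexPotential_eq hdV]
    simp only [hGopν]
    exact sum_convex_le hh.2 hmono (hpos hG.1) hvpos hc0 (hsum hG) (hup hG.1) (hdown hG.1)
  · intro h hh hmono hstrict G hG heq
    rw [hGop.convexPotential_eq hdV, hG.1.convexPotential_eq hdV] at heq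
    simp only [hGopν] at heq
    have hμ := congrFun (eq_of_sum_convex_eq hstrict hmono (hpos hG.1) hvpos hc0 (hsum hG)
      (hup hG.1) (hdown hG.1) heq)
    exact ⟨hspec hG.1 hμ, hG.1.exists_opposite_eigenbasis hVW hF hdV hμ⟩
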